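/- **Setting.** Let $L=\bigcup_{n\in\mathbb N}L_n$ be an alphabet, where the $L_n$ are finite and $L_n\subseteq L_{n+1}$ for all $n$, and let $v\notin L$ be a variable. $W_L$ is the set of words over $L$, and $W_{Lv}$ is the set of words over $L\cup\{v\}$ in which $v$ occurs. A sequence of words $(x_n)_{n\in\mathbb N}$ is *rapidly increasing* if $|x_n|>\sum_{i<n}|x_i|$ for all $n$. Let $W_L^{[\infty]}$ and $W_{Lv}^{[\infty]}$ be the sets of rapidly increasing infinite sequences in $W_L$ and in $W_{Lv}$, respectively. For $x\in W_{Lv}$, let $x[\lambda]$ be the result of replacing $v$ by $\lambda$ in $x$. For $X=(x_n)_n\in W_{Lv}^{[\infty]}$, let $[X]_L$ be the set of all words $w=x_{n_0}[\lambda_0]^\smallfrown\cdots^\smallfrown x_{n_k}[\lambda_k]$ with $k\ge 0$, $n_0<\cdots<n_k$ and $\lambda_i\in L_{n_i}$, and let $[X]_{Lv}$ be the set of all such $w\in W_{Lv}$ with $\lambda_i\in L_{n_i}\cup\{v\}$. The set $\{n_0,\dots,n_k\}$ is uniquely determined by $w$ and $X$; it is denoted by $\mathrm{supp}_X(w)$.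 For $Y=(y_n)_n\in W_{Lv}^{[\infty]}$ write $Y\le X$ if $y_n\in[X]_{Lv}$ for all $n$ and $\max\mathrm{supp}_X(y_n)<\min\mathrm{supp}_X(y_m)$ for all $n<m$. For $A=(w_n)_n\in W_L^{[\infty]}$ write $A\le^0X$ if $w_n\in[X]_L$ for all $n$ and $\max\mathrm{supp}_X(w_n)<\min\mathrm{supp}_X(w_m)$ for all $n<m$. For a finite sequence $a$ of words over $L$ and $Y\in W_{Lv}^{[\infty]}$, let $$[a,Y]=\{A\in W_L^{[\infty]}: A\le^0Y\text{ and } a\text{ is an initial segment of }A\}.$$ If $[a,Y]\ne\emptyset$, let $\mathrm{depth}_Y(a)$ be the least $k$ such that every word of $a$ lies in $[Y]_L$ with support in $Y$ contained in $\{0,\dots,k-1\}$, the supports of the successive words of $a$ being in increasing block position as above. For $n\in\mathbb N$, let $[n,Y]$ be the set of all $X\in W_{Lv}^{[\infty]}$ with $X\le Y$ whose first $n$ terms are those of $Y$. Let $\mathbb P$ be the family of nonempty perfect subsets of the Cantor space $2^\infty$, and let $\Lambda\subseteq 2^\infty\times W_L^{[\infty]}$. * $\Lambda$ is *perfectly Ramsey*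 if for every $Q\in\mathbb P$ and every $[a,Y]\neq\emptyset$ there are $M\in\mathbb P$ with $M\subseteq Q$ and $X\in[\mathrm{depth}_Y(a),Y]$ with $[a,X]\ne\emptyset$ such that $M\times[a,X]\subseteq\Lambda$ or $M\times[a,X]\subseteq\Lambda^c$. It is *perfectly Ramsey null* if in this situation $M$ and $X$ can always be found with $M\times[a,X]\subseteq\Lambda^c$. * $\Lambda$ has the *$\mathbb P\times W_{Lv}^{[\infty]}$-Baire property* if for every $Q\in\mathbb P$ and every $[a,Y]\neq\emptyset$ there are $M\in\mathbb P$ with $M\subseteq Q$ and a nonempty $[b,X]\subseteq[a,Y]$ such that $M\times[b,X]\subseteq\Lambda$ or $M\times[b,X]\subseteq\Lambda^c$. It is *$\mathbb P\times W_{Lv}^{[\infty]}$-meager* if in this situation $M$ and $[b,X]$ can always be found with $M\times[b,X]\subseteq\Lambda^c$. **Theorem (Parametrized infinite dimensional Hales–Jewett theorem).** For every $\Lambda\subseteq 2^\infty\times W_L^{[\infty]}$: 1. $\Lambda$ is perfectly Ramsey if and only if it has the $\mathbb P\times W_{Lv}^{[\infty]}$-Baire property. 2. $\Lambda$ is perfectly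 Ramsey null if and only if it is $\mathbb P\times W_{Lv}^{[\infty]}$-meager. -/

import Mathlib

namespace HalesJewettSpace

/-- A sequence of words is rapidly increasing if each word is strictly longer than all the
previous ones put together (in particular every word is nonempty). -/
def RapidlyIncreasing {β : Type*} (x : ℕ → List β) : Prop :=
  ∀ n, ∑ i ∈ Finset.range n, (x i).length < (x n).length

/-- Rapidly increasing infinite sequences of words over the alphabet `α`. -/
def WordSeq (α : Type*) : Type _ :=
  {A : ℕ → List α // RapidlyIncreasing A}

/-- Rapidly increasing infinite sequences of variable words over `α`. The letters of a variable
word are taken in `Option α`, where `none` is the variable `v`, which has to occur. -/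
def VarWordSeq (α : Type*) : Type _ :=
  {X : ℕ → List (Option α) // (∀ n, none ∈ X n) ∧ RapidlyIncreasing X}

/-- The evaluation `x[l]` of a variable word at a letter `l`. -/
def eval {α : Type*} (x : List (Option α)) (l : α) : List α :=
  x.map fun c => c.getD l

/-- The evaluation `x[l]` of a variable word at `l`, a letter or the variable (`x[v] = x`). -/
def evalVar {α : Type*} (x : List (Option α)) (l : Option α) : List (Option α) :=
  x.map fun c => c.elim l some

/-- `w` is the word `x_{n_0}[l_0] ⌢ ⋯ ⌢ x_{n_k}[l_k]` for some letters `l_i ∈ L_{n_i}`, where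
`s = {n_0 < ⋯ < n_k}` is nonempty: `w` lies in the combinatorial subspace `[X]_L`
and has support `s` in `X`. -/
def IsSupp {α : Type*} (L : ℕ → Finset α) (X : VarWordSeq α) (w : List α)
    (s : Finset ℕ) : Prop :=
  s.Nonempty ∧ ∃ l : ℕ → α, (∀ n ∈ s, l n ∈ L n) ∧
    w = (s.sort (· ≤ ·)).flatMap fun n => eval (X.1 n) (l n)

/-- `w` is the variable word `x_{n_0}[l_0] ⌢ ⋯ ⌢ x_{n_k}[l_k]` for some `l_i ∈ L_{n_i} ∪ {v}`,
where `s = {n_0 < ⋯ < n_k}` is nonempty: `w` lies in the combinatorial subspace `[X]_{Lv}`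
and has support `s` in `X`. -/
def IsSuppVar {α : Type*} (L : ℕ → Finset α) (X : VarWordSeq α) (w : List (Option α))
    (s : Finset ℕ) : Prop :=
  s.Nonempty ∧ none ∈ w ∧ ∃ l : ℕ → Option α, (∀ n ∈ s, l n ∈ Finset.insertNone (L n)) ∧
    w = (s.sort (· ≤ ·)).flatMap fun n => evalVar (X.1 n) (l n)

theorem RapidlyIncreasing.finset_eq {β : Type*} {x : ℕ → List β} (hx : RapidlyIncreasing x)
    (N : ℕ) : ∀ s t : Finset ℕ, s ⊆ Finset.range N → t ⊆ Finset.range N →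
      ∑ n ∈ s, (x n).length = ∑ n ∈ t, (x n).length → s = t := by
  induction N with
  | zero =>
    intro s t hs ht _
    rw [Finset.range_zero, Finset.subset_empty] at hs ht
    rw [hs, ht]
  | succ N ih =>
    intro s t hs ht h
    have key : ∀ u : Finset ℕ, u ⊆ Finset.range (N + 1) →
        u.erase N ⊆ Finset.range N := by
      intro u hu n hn
      have h1 := Finset.mem_range.1 (hu (Finset.mem_of_mem_erase hn))
      have h2 := Finset.ne_of_mem_erase hn
      exact Finset.mem_range.2 (by omega)
    have bound : ∀ u : Finset ℕ, u ⊆ Finset.range N →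
        ∑ n ∈ u, (x n).length < (x N).length := fun u hu =>
      (Finset.sum_le_sum_of_subset hu).trans_lt (hx N)
    by_cases h1 : N ∈ s <;> by_cases h2 : N ∈ t
    · rw [← Finset.add_sum_erase s _ h1, ← Finset.add_sum_erase t _ h2] at h
      rw [← Finset.insert_erase h1, ← Finset.insert_erase h2,
        ih _ _ (key s hs) (key t ht) (Nat.add_left_cancel h)]
    · have := bound t (by have := key t ht; rwa [Finset.erase_eq_of_notMem h2] at this)
      rw [← Finset.add_sum_erase s _ h1] at h
      omega
    · have := bound s (by have := key s hs; rwa [Finset.erase_eq_of_notMem h1] at this)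
      rw [← Finset.add_sum_erase t _ h2] at h
      omega
    · have h3 := key s hs
      have h4 := key t ht
      rw [Finset.erase_eq_of_notMem h1] at h3
      rw [Finset.erase_eq_of_notMem h2] at h4
      exact ih s t h3 h4 h

theorem RapidlyIncreasing.finset_eq' {β : Type*} {x : ℕ → List β} (hx : RapidlyIncreasing x)
    {s t : Finset ℕ} (h : ∑ n ∈ s, (x n).length = ∑ n ∈ t, (x n).length) : s = t := by
  obtain ⟨N, hN⟩ := (s ∪ t).exists_nat_subset_range
  exact hx.finset_eq N s t (Finset.subset_union_left.trans hN)
    (Finset.subset_union_right.trans hN) h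

theorem length_flatMap_sort {β : Type*} (s : Finset ℕ) (f : ℕ → List β) :
    ((s.sort (· ≤ ·)).flatMap f).length = ∑ n ∈ s, (f n).length := by
  rw [List.length_flatMap, Finset.sum_eq_multiset_sum, ← Finset.sort_eq s (· ≤ ·)]
  rw [Multiset.map_coe, Multiset.sum_coe]

/-- The support of a word in `X` is unique. -/
theorem IsSupp.unique {α : Type*} {L : ℕ → Finset α} {X : VarWordSeq α} {w : List α}
    {s t : Finset ℕ} (hs : IsSupp L X w s) (ht : IsSupp L X w t) : s = t := by
  obtain ⟨-, l, -, h⟩ := hs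
  obtain ⟨-, m, -, h'⟩ := ht
  apply X.2.2.finset_eq'
  have := congrArg List.length (h.symm.trans h')
  simpa only [length_flatMap_sort, eval, List.length_map] using this

/-- The support of a variable word in `X` is unique. -/
theorem IsSuppVar.unique {α : Type*} {L : ℕ → Finset α} {X : VarWordSeq α}
    {w : List (Option α)} {s t : Finset ℕ} (hs : IsSuppVar L X w s) (ht : IsSuppVar L X w t) :
    s = t := by
  obtain ⟨-, -, l, -, h⟩ := hs
  obtain ⟨-, -, m, -, h'⟩ := ht
  apply X.2.2.finset_eq'
  have := congrArg List.length (h.symm.trans h')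
  simpa only [length_flatMap_sort, evalVar, List.length_map] using this

/-- `Y ≤ X`: `Y` is a block subsequence of `X`, that is, all `y_n` lie in `[X]_{Lv}` and
`max (supp_X y_n) < min (supp_X y_m)` for `n < m`. -/
def BlockLE {α : Type*} (L : ℕ → Finset α) (Y X : VarWordSeq α) : Prop :=
  ∃ S : ℕ → Finset ℕ, (∀ n, IsSuppVar L X (Y.1 n) (S n)) ∧
    ∀ n m, n < m → ∀ i ∈ S n, ∀ j ∈ S m, i < j

/-- `A ≤⁰ X`: all words of `A` lie in `[X]_L`, and their supports in `X` form a block sequence. -/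
def BlockLE₀ {α : Type*} (L : ℕ → Finset α) (A : WordSeq α) (X : VarWordSeq α) : Prop :=
  ∃ S : ℕ → Finset ℕ, (∀ n, IsSupp L X (A.1 n) (S n)) ∧
    ∀ n m, n < m → ∀ i ∈ S n, ∀ j ∈ S m, i < j

/-- `a ≤⁰_fin (x_0, …, x_{k-1})`: the words of the finite sequence `a` are built from
`x_0, …, x_{k-1}`, with supports that form a block sequence. -/
def FinLE₀ {α : Type*} (L : ℕ → Finset α) (a : List (List α)) (X : VarWordSeq α)
    (k : ℕ) : Prop :=
  ∃ S : ℕ → Finset ℕ,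
    (∀ n (hn : n < a.length), IsSupp L X a[n] (S n) ∧ S n ⊆ Finset.range k) ∧
    ∀ n m, n < m → m < a.length → ∀ i ∈ S n, ∀ j ∈ S m, i < j

/-- The depth of `a` in `Y`: the least `k` with `a ≤⁰_fin (y_0, …, y_{k-1})`. It is used only
when the basic set `[a, Y]` is nonempty, and then such a `k` exists. -/
noncomputable def depth {α : Type*} (L : ℕ → Finset α) (Y : VarWordSeq α)
    (a : List (List α)) : ℕ :=
  sInf {k | FinLE₀ L a Y k}

/-- The initial segment `(x_0, …, x_{n-1})` of a sequence. -/
def initSeg {β : Type*} (x : ℕ → β) (n : ℕ) : List β :=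
  (List.range n).map x

/-- The basic set `[a, Y]` of all `A ≤⁰ Y` that have `a` as an initial segment. -/
def basic {α : Type*} (L : ℕ → Finset α) (a : List (List α)) (Y : VarWordSeq α) :
    Set (WordSeq α) :=
  {A | BlockLE₀ L A Y ∧ ∃ n, initSeg A.1 n = a}

/-- The basic set `[n, Y]` of all `X ≤ Y` that have `(y_0, …, y_{n-1})` as an initial segment. -/
def basicVar {α : Type*} (L : ℕ → Finset α) (n : ℕ) (Y : VarWordSeq α) :
    Set (VarWordSeq α) :=
  {X | BlockLE L X Y ∧ ∃ m, initSeg X.1 m = initSeg Y.1 n}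

/-- The family of nonempty perfect subsets of the Cantor space. -/
def perfectSets : Set (Set (ℕ → Bool)) :=
  {Q | Perfect Q ∧ Q.Nonempty}

def PerfectlyRamsey {α : Type*} (L : ℕ → Finset α) (Λ : Set ((ℕ → Bool) × WordSeq α)) : Prop :=
  ∀ Q ∈ perfectSets, ∀ (a : List (List α)) (Y : VarWordSeq α), (basic L a Y).Nonempty →
    ∃ M ∈ perfectSets, M ⊆ Q ∧ ∃ X ∈ basicVar L (depth L Y a) Y, (basic L a X).Nonempty ∧
      (M ×ˢ basic L a X ⊆ Λ ∨ M ×ˢ basic L a X ⊆ Λᶜ)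

def PerfectlyRamseyNull {α : Type*} (L : ℕ → Finset α) (Λ : Set ((ℕ → Bool) × WordSeq α)) :
    Prop :=
  ∀ Q ∈ perfectSets, ∀ (a : List (List α)) (Y : VarWordSeq α), (basic L a Y).Nonempty →
    ∃ M ∈ perfectSets, M ⊆ Q ∧ ∃ X ∈ basicVar L (depth L Y a) Y, (basic L a X).Nonempty ∧
      M ×ˢ basic L a X ⊆ Λᶜ

/-- The Baire property with respect to products of perfect sets and basic sets. -/
def PerfectlyBaire {α : Type*} (L : ℕ → Finset α) (Λ : Set ((ℕ → Bool) × WordSeq α)) : Prop :=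
  ∀ Q ∈ perfectSets, ∀ (a : List (List α)) (Y : VarWordSeq α), (basic L a Y).Nonempty →
    ∃ M ∈ perfectSets, M ⊆ Q ∧ ∃ (b : List (List α)) (X : VarWordSeq α),
      (basic L b X).Nonempty ∧ basic L b X ⊆ basic L a Y ∧
      (M ×ˢ basic L b X ⊆ Λ ∨ M ×ˢ basic L b X ⊆ Λᶜ)

/-- Meagerness with respect to products of perfect sets and basic sets. -/
def PerfectlyMeager {α : Type*} (L : ℕ → Finset α) (Λ : Set ((ℕ → Bool) × WordSeq α)) : Prop :=
  ∀ Q ∈ perfectSets, ∀ (a : List (List α)) (Y : VarWordSeq α), (basic L a Y).Nonempty →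
    ∃ M ∈ perfectSets, M ⊆ Q ∧ ∃ (b : List (List α)) (X : VarWordSeq α),
      (basic L b X).Nonempty ∧ basic L b X ⊆ basic L a Y ∧ M ×ˢ basic L b X ⊆ Λᶜ

end HalesJewettSpace

/-!
An idempotent ultrafilter `u` on the words over `L`, taken in a minimal left ideal, is the image of
one ultrafilter `v` on the variable words under every substitution `x ↦ x[l]`. This gives a
pigeonhole principle for `[X]_L`. It is parametrized by a perfect set along a Cantor scheme: the
pieces of the scheme stay uncountable and are shrunk so that all points of a piece agree on the
finitely many words built so far.

The Baire property is upgraded by combinatorial forcing. A fusion makes the alternative between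
deciding `b` and rejecting all its one-word extensions hold for all finite block sequences `b` at
once; the pigeonhole principle makes this alternative dense. Rejecting `a` would then mean
rejecting all its extensions, against the Baire property. If `a` is not rejected, it is decided on
some nonempty `[a, Z] ⊆ [a, X]`, and such a `[a, Z]` contains some `[a, Y]` for which `Y` starts
with the prescribed initial segment of `X`, since two letters determine a variable word.
-/

namespace HalesJewettSpace

section Concatenation

variable {β γ : Type*}

/-- The concatenation of the words `f n`, `n ∈ s`, in increasing order of `n`. -/
def cat (f : ℕ → List β) (s : Finset ℕ) : List β :=
  (s.sort (· ≤ ·)).flatMap f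

theorem cat_empty (f : ℕ → List β) : cat f ∅ = [] := by simp [cat]

theorem cat_insert (f : ℕ → List β) {s : Finset ℕ} {m : ℕ} (hm : ∀ i ∈ s, i < m) :
    cat f (insert m s) = cat f s ++ f m := by
  have hnodup : (s.sort (· ≤ ·) ++ [m]).Nodup := by
    simpa [List.nodup_append] using fun i hi => (hm i hi).ne
  have hsorted : (s.sort (· ≤ ·) ++ [m]).Pairwise (· ≤ ·) := by
    simpa [List.pairwise_append] using fun i hi => (hm i hi).le
  have hfinset : (s.sort (· ≤ ·) ++ [m]).toFinset = insert m s := by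
    ext; simp
  have hsort : (insert m s).sort (· ≤ ·) = s.sort (· ≤ ·) ++ [m] := by
    rw [← hfinset, (List.toFinset_sort (· ≤ ·) hnodup).2 hsorted]
  simp [cat, hsort]

theorem cat_congr {f g : ℕ → List β} {s : Finset ℕ} (h : ∀ n ∈ s, f n = g n) :
    cat f s = cat g s :=
  List.flatMap_congr fun n hn => h n ((Finset.mem_sort _).1 hn)

/-- `w` is a concatenation of words `g n ∈ P n`, `n ∈ s`, in increasing order of `n`. -/
def IsConcat (P : ℕ → Set (List β)) (w : List β) (s : Finset ℕ) : Prop :=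
  ∃ g : ℕ → List β, (∀ n ∈ s, g n ∈ P n) ∧ w = cat g s

variable {P Q : ℕ → Set (List β)} {w w' : List β} {s t : Finset ℕ}

theorem isConcat_empty : IsConcat P w ∅ ↔ w = [] := by
  simp [IsConcat, cat_empty]

theorem isConcat_insert {m : ℕ} (hm : ∀ i ∈ s, i < m) :
    IsConcat P w (insert m s) ↔ ∃ w', IsConcat P w' s ∧ ∃ z ∈ P m, w = w' ++ z := by
  constructor
  · rintro ⟨g, hg, rfl⟩
    exact ⟨cat g s, ⟨g, fun n hn => hg n (Finset.mem_insert_of_mem hn), rfl⟩, g m,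
      hg m (Finset.mem_insert_self m s), cat_insert g hm⟩
  · rintro ⟨_, ⟨g, hg, rfl⟩, z, hz, rfl⟩
    refine ⟨Function.update g m z, fun n hn => ?_, ?_⟩
    · rcases Finset.mem_insert.1 hn with rfl | hn
      · rwa [Function.update_self]
      · rw [Function.update_of_ne (hm n hn).ne]
        exact hg n hn
    · rw [cat_insert _ hm, Function.update_self,
        cat_congr fun n hn => Function.update_of_ne (hm n hn).ne z g]

theorem isConcat_singleton {n : ℕ} : IsConcat P w {n} ↔ w ∈ P n := by
  rw [← insert_empty_eq, isConcat_insert (by simp)]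
  simp [isConcat_empty]

theorem IsConcat.append (hw : IsConcat P w s) (hw' : IsConcat P w' t)
    (hst : ∀ i ∈ s, ∀ j ∈ t, i < j) : IsConcat P (w ++ w') (s ∪ t) := by
  induction t using Finset.induction_on_max generalizing w' with
  | empty => simpa [isConcat_empty.1 hw'] using hw
  | insert m t hm ih =>
    obtain ⟨w'', hw'', z, hz, rfl⟩ := (isConcat_insert hm).1 hw'
    rw [Finset.union_insert, ← List.append_assoc, isConcat_insert]
    · exact ⟨_, ih hw'' fun i hi j hj => hst i hi j (Finset.mem_insert_of_mem hj), z, hz, rfl⟩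
    · intro i hi
      exact (Finset.mem_union.1 hi).elim (hst i · m (Finset.mem_insert_self m t)) (hm i)

theorem IsConcat.map {Q : ℕ → Set (List γ)} (φ : β → γ) (hw : IsConcat P w s)
    (hPQ : ∀ n ∈ s, ∀ x ∈ P n, x.map φ ∈ Q n) : IsConcat Q (w.map φ) s := by
  obtain ⟨g, hg, rfl⟩ := hw
  exact ⟨fun n => (g n).map φ, fun n hn => hPQ n hn _ (hg n hn), List.map_flatMap⟩

theorem IsConcat.length {ℓ : ℕ → ℕ} (hw : IsConcat P w s)
    (hP : ∀ n, ∀ x ∈ P n, x.length = ℓ n) : w.length = ∑ n ∈ s, ℓ n := by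
  obtain ⟨g, hg, rfl⟩ := hw
  rw [cat, length_flatMap_sort]
  exact Finset.sum_congr rfl fun n hn => hP n _ (hg n hn)

theorem finite_setOf_isConcat (hP : ∀ n ∈ s, (P n).Finite) : {w | IsConcat P w s}.Finite := by
  induction s using Finset.induction_on_max with
  | empty => simp [isConcat_empty]
  | insert m s hm ih =>
    refine ((ih fun n hn => hP n (Finset.mem_insert_of_mem hn)).image2 (· ++ ·)
      (hP m (Finset.mem_insert_self m s))).subset fun w hw => ?_
    obtain ⟨w', hw', z, hz, rfl⟩ := (isConcat_insert hm).1 hw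
    exact ⟨w', hw', z, hz, rfl⟩

/-- The sets of a sequence are in increasing block position. -/
def IsBlock (S : ℕ → Finset ℕ) : Prop :=
  ∀ n m, n < m → ∀ i ∈ S n, ∀ j ∈ S m, i < j

theorem isBlock_singleton {φ : ℕ → ℕ} (hφ : StrictMono φ) : IsBlock fun n => {φ n} := by
  simpa [IsBlock] using fun n m hnm => hφ hnm

theorem IsBlock.biUnion {S T : ℕ → Finset ℕ} (hS : IsBlock S) (hT : IsBlock T) :
    IsBlock fun n => (T n).biUnion S := by
  intro n m hnm i hi j hj
  obtain ⟨k, hk, hi⟩ := Finset.mem_biUnion.1 hi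
  obtain ⟨l, hl, hj⟩ := Finset.mem_biUnion.1 hj
  exact hS k l (hT n m hnm k hk l hl) i hi j hj

theorem IsConcat.biUnion {S : ℕ → Finset ℕ} (hS : IsBlock S) (hw : IsConcat P w s)
    (hPQ : ∀ n ∈ s, ∀ x ∈ P n, IsConcat Q x (S n)) : IsConcat Q w (s.biUnion S) := by
  induction s using Finset.induction_on_max generalizing w with
  | empty => simpa [isConcat_empty] using hw
  | insert m s hm ih =>
    obtain ⟨w', hw', z, hz, rfl⟩ := (isConcat_insert hm).1 hw
    rw [Finset.biUnion_insert, Finset.union_comm]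
    refine (ih hw' fun n hn => hPQ n (Finset.mem_insert_of_mem hn)).append
      (hPQ m (Finset.mem_insert_self m s) z hz) fun i hi j hj => ?_
    obtain ⟨n, hn, hi⟩ := Finset.mem_biUnion.1 hi
    exact hS n m (hm n hn) i hi j hj

theorem le_of_mem_of_block {S : ℕ → Finset ℕ} {N : ℕ} (hne : ∀ n < N, (S n).Nonempty)
    (hS : ∀ n m, n < m → m < N → ∀ i ∈ S n, ∀ j ∈ S m, i < j) {n j : ℕ} (hn : n < N)
    (hj : j ∈ S n) : n ≤ j := by
  induction n generalizing j with
  | zero => exact j.zero_le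
  | succ n ih =>
    obtain ⟨i, hi⟩ := hne n (by omega)
    exact (ih (by omega) hi).trans_lt (hS n (n + 1) n.lt_succ_self hn i hi j hj)

theorem IsBlock.le {S : ℕ → Finset ℕ} (hS : IsBlock S) (hne : ∀ n, (S n).Nonempty) {n j : ℕ}
    (hj : j ∈ S n) : n ≤ j :=
  le_of_mem_of_block (N := n + 1) (fun i _ => hne i) (fun i m him _ => hS i m him)
    n.lt_succ_self hj

theorem IsBlock.pairwiseDisjoint {S : ℕ → Finset ℕ} (hS : IsBlock S) (I : Set ℕ) :
    I.PairwiseDisjoint S := by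
  intro n _ m _ hnm
  refine Finset.disjoint_left.2 fun i hi hi' => ?_
  rcases hnm.lt_or_gt with h | h
  · exact lt_irrefl i (hS n m h i hi i hi')
  · exact lt_irrefl i (hS m n h i hi' i hi)

theorem RapidlyIncreasing.of_isBlock {x : ℕ → List β} (hx : RapidlyIncreasing x)
    {y : ℕ → List γ} {S : ℕ → Finset ℕ} (hS : IsBlock S) (hne : ∀ n, (S n).Nonempty)
    (hy : ∀ n, (y n).length = ∑ j ∈ S n, (x j).length) : RapidlyIncreasing y := by
  intro n
  obtain ⟨m, hm⟩ := hne n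
  calc ∑ i ∈ Finset.range n, (y i).length
      = ∑ j ∈ (Finset.range n).biUnion S, (x j).length := by
        rw [Finset.sum_biUnion (hS.pairwiseDisjoint _)]
        exact Finset.sum_congr rfl fun i _ => hy i
    _ ≤ ∑ j ∈ Finset.range m, (x j).length := by
        refine Finset.sum_le_sum_of_subset fun j hj => ?_
        obtain ⟨i, hi, hj⟩ := Finset.mem_biUnion.1 hj
        exact Finset.mem_range.2 (hS i n (Finset.mem_range.1 hi) j hj m hm)
    _ < (x m).length := hx m
    _ ≤ ∑ j ∈ S n, (x j).length :=
        Finset.single_le_sum (f := fun j => (x j).length) (fun _ _ => Nat.zero_le _) hm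
    _ = (y n).length := (hy n).symm

/-- The nonempty concatenations of words from the sets `P n` with `n ≥ m`, at most one from each
and in increasing order of `n`. -/
def tail (P : ℕ → Set (List β)) (m : ℕ) : Set (List β) :=
  {w | ∃ s : Finset ℕ, s.Nonempty ∧ (∀ j ∈ s, m ≤ j) ∧ IsConcat P w s}

theorem tail_antitone (P : ℕ → Set (List β)) : Antitone (tail P) :=
  fun _ _ hmn _ ⟨s, hs, hns, hw⟩ => ⟨s, hs, fun j hj => hmn.trans (hns j hj), hw⟩

theorem exists_append_mem_tail {m : ℕ} (hw : w ∈ tail P m) :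
    ∃ k, ∀ w' ∈ tail P k, w ++ w' ∈ tail P m := by
  obtain ⟨s, hs, hms, hw⟩ := hw
  obtain ⟨k, hk⟩ := (insert m s).exists_nat_subset_range
  have hlt : ∀ i ∈ insert m s, i < k := fun i hi => Finset.mem_range.1 (hk hi)
  refine ⟨k, fun w' ⟨t, _, hkt, hw'⟩ => ⟨s ∪ t, hs.mono Finset.subset_union_left, ?_,
    hw.append hw' fun i hi j hj => (hlt i (Finset.mem_insert_of_mem hi)).trans_le (hkt j hj)⟩⟩
  intro j hj
  exact (Finset.mem_union.1 hj).elim (hms j)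
    fun hj => (hlt m (Finset.mem_insert_self m s)).le.trans (hkt j hj)

end Concatenation

section BlockSequences

variable {β : Type*} {R : β → Finset ℕ → Prop} {d k : ℕ} {w : ℕ → β}

/-- The sequence that starts with the list `a` and continues with `w`. -/
def prepend (a : List β) (w : ℕ → β) (n : ℕ) : β :=
  a.getD n (w (n - a.length))

theorem prepend_of_lt {a : List β} {n : ℕ} (hn : n < a.length) : prepend a w n = a[n] :=
  List.getD_eq_getElem a _ hn

theorem prepend_length_add (a : List β) (w : ℕ → β) (n : ℕ) :
    prepend a w (a.length + n) = w n := by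
  rw [prepend, List.getD_eq_default _ _ (Nat.le_add_right _ _), Nat.add_sub_cancel_left]

/-- With `R x s` read as "`s` is a support of `x`": the terms of `w` have supports that form a
block sequence of subsets of `{d, d + 1, …}`. -/
def IsBlockSeq (R : β → Finset ℕ → Prop) (d : ℕ) (w : ℕ → β) : Prop :=
  ∃ S : ℕ → Finset ℕ, IsBlock S ∧ ∀ n, R (w n) (S n) ∧ ∀ j ∈ S n, d ≤ j

/-- With `R x s` read as "`s` is a support of `x`": the entries of `a` have supports that form a
block sequence of subsets of `{0, …, k - 1}`. -/
def IsFinBlockSeq (R : β → Finset ℕ → Prop) (k : ℕ) (a : List β) : Prop :=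
  ∃ S : ℕ → Finset ℕ,
    (∀ n (hn : n < a.length), R a[n] (S n) ∧ S n ⊆ Finset.range k) ∧
    ∀ n m, n < m → m < a.length → ∀ i ∈ S n, ∀ j ∈ S m, i < j

theorem isBlockSeq_of_strictMono {φ : ℕ → ℕ} (hφ : StrictMono φ)
    (hw : ∀ n, R (w n) {φ n}) (hd : ∀ n, d ≤ φ n) : IsBlockSeq R d w :=
  ⟨fun n => {φ n}, isBlock_singleton hφ, fun n => ⟨hw n, by simpa using hd n⟩⟩

theorem IsFinBlockSeq.prepend {a : List β} (ha : IsFinBlockSeq R d a) (hw : IsBlockSeq R d w) :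
    IsBlockSeq R 0 (prepend a w) := by
  obtain ⟨T, hT, hTblock⟩ := ha
  obtain ⟨S, hSblock, hS⟩ := hw
  refine ⟨fun n => if n < a.length then T n else S (n - a.length), ?_, fun n => ⟨?_, by simp⟩⟩
  · intro n m hnm i hi j hj
    dsimp only at hi hj
    split_ifs at hi hj with hn hm hm
    · exact hTblock n m hnm hm i hi j hj
    · exact (Finset.mem_range.1 ((hT n hn).2 hi)).trans_le ((hS _).2 j hj)
    · omega
    · exact hSblock _ _ (by omega) i hi j hj
  · dsimp only
    split_ifs with hn
    · rw [prepend_of_lt hn]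
      exact (hT n hn).1
    · obtain ⟨i, rfl⟩ := Nat.exists_eq_add_of_le (not_lt.1 hn)
      rw [prepend_length_add, Nat.add_sub_cancel_left]
      exact (hS i).1

theorem IsBlockSeq.cons {x : β} {s : Finset ℕ} (hx : R x s) (hds : ∀ j ∈ s, d ≤ j)
    (hsk : ∀ j ∈ s, j < k) (hdk : d ≤ k) (hw : IsBlockSeq R k w) :
    IsBlockSeq R d fun n => n.casesOn x w := by
  obtain ⟨S, hSblock, hS⟩ := hw
  refine ⟨fun n => n.casesOn s S, ?_, ?_⟩
  · rintro (_ | n) (_ | m) hnm i hi j hj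
    · exact absurd hnm (lt_irrefl 0)
    · exact (hsk i hi).trans_le ((hS m).2 j hj)
    · exact absurd hnm (by omega)
    · exact hSblock n m (by omega) i hi j hj
  · rintro (_ | n)
    · exact ⟨hx, hds⟩
    · exact ⟨(hS n).1, fun j hj => hdk.trans ((hS n).2 j hj)⟩

end BlockSequences

section Supports

variable {α : Type*} {L : ℕ → Finset α} {X Y Z : VarWordSeq α}

/-- The words `x_n[l]` with `l ∈ L_n`. -/
def pieces (L : ℕ → Finset α) (X : VarWordSeq α) (n : ℕ) : Set (List α) :=
  {w | ∃ l ∈ L n, w = eval (X.1 n) l}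

/-- The words `x_n[l]` with `l ∈ L_n ∪ {v}`. -/
def piecesVar (L : ℕ → Finset α) (X : VarWordSeq α) (n : ℕ) : Set (List (Option α)) :=
  {w | ∃ l ∈ Finset.insertNone (L n), w = evalVar (X.1 n) l}

theorem isSupp_iff {w : List α} {s : Finset ℕ} :
    IsSupp L X w s ↔ s.Nonempty ∧ IsConcat (pieces L X) w s := by
  refine and_congr_right fun ⟨m, hm⟩ => ⟨?_, ?_⟩
  · rintro ⟨l, hl, rfl⟩
    exact ⟨_, fun n hn => ⟨l n, hl n hn, rfl⟩, rfl⟩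
  · rintro ⟨g, hg, rfl⟩
    have : Nonempty α := ⟨(hg m hm).choose⟩
    choose! l hl hgl using hg
    exact ⟨l, hl, cat_congr hgl⟩

theorem isSuppVar_iff {w : List (Option α)} {s : Finset ℕ} :
    IsSuppVar L X w s ↔ s.Nonempty ∧ none ∈ w ∧ IsConcat (piecesVar L X) w s := by
  refine and_congr_right fun _ => and_congr_right fun _ => ⟨?_, ?_⟩
  · rintro ⟨l, hl, rfl⟩
    exact ⟨_, fun n hn => ⟨l n, hl n hn, rfl⟩, rfl⟩
  · rintro ⟨g, hg, rfl⟩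
    choose! l hl hgl using hg
    exact ⟨l, hl, cat_congr hgl⟩

theorem evalVar_none (x : List (Option α)) : evalVar x none = x := by
  conv_rhs => rw [← List.map_id x]
  exact List.map_congr_left fun c _ => by cases c <;> rfl

theorem evalVar_evalVar (x : List (Option α)) (l m : Option α) :
    evalVar (evalVar x l) m = evalVar x (l.elim m some) := by
  rw [evalVar, evalVar, evalVar, List.map_map]
  exact List.map_congr_left fun c _ => by cases c <;> rfl

theorem eval_evalVar (x : List (Option α)) (l : Option α) (m : α) :
    eval (evalVar x l) m = eval x (l.getD m) := by
  rw [evalVar, eval, eval, List.map_map]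
  exact List.map_congr_left fun c _ => by cases c <;> cases l <;> rfl

theorem map_some_eval (x : List (Option α)) (l : α) :
    (eval x l).map some = evalVar x (some l) := by
  rw [evalVar, eval, List.map_map]
  exact List.map_congr_left fun c _ => by cases c <;> rfl

theorem length_eval (x : List (Option α)) (l : α) : (eval x l).length = x.length :=
  List.length_map _

theorem length_evalVar (x : List (Option α)) (l : Option α) :
    (evalVar x l).length = x.length :=
  List.length_map _

theorem IsSupp.length {w : List α} {s : Finset ℕ} (hw : IsSupp L X w s) :
    w.length = ∑ j ∈ s, (X.1 j).length :=
  (isSupp_iff.1 hw).2.length fun _ _ ⟨_, _, hx⟩ => hx ▸ length_eval _ _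

theorem IsSuppVar.length {w : List (Option α)} {s : Finset ℕ} (hw : IsSuppVar L X w s) :
    w.length = ∑ j ∈ s, (X.1 j).length :=
  (isSuppVar_iff.1 hw).2.2.length fun _ _ ⟨_, _, hx⟩ => hx ▸ length_evalVar _ _

theorem isConcat_eval {w : List (Option α)} {s : Finset ℕ} (hw : IsConcat (piecesVar L X) w s)
    {l : α} (hl : ∀ n ∈ s, l ∈ L n) : IsConcat (pieces L X) (eval w l) s := by
  refine hw.map _ ?_
  rintro n hn _ ⟨m, hm, rfl⟩
  refine ⟨m.getD l, ?_, eval_evalVar _ _ _⟩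
  cases m with
  | none => exact hl n hn
  | some m => simpa using hm

theorem isConcat_evalVar {w : List (Option α)} {s : Finset ℕ}
    (hw : IsConcat (piecesVar L X) w s) {l : Option α}
    (hl : ∀ n ∈ s, l ∈ Finset.insertNone (L n)) :
    IsConcat (piecesVar L X) (evalVar w l) s := by
  refine hw.map _ ?_
  rintro n hn _ ⟨m, hm, rfl⟩
  refine ⟨m.elim l some, ?_, evalVar_evalVar _ _ _⟩
  cases m with
  | none => exact hl n hn
  | some m => exact hm

theorem IsSuppVar.eval {w : List (Option α)} {s : Finset ℕ} (hw : IsSuppVar L X w s) {l : α}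
    (hl : ∀ n ∈ s, l ∈ L n) : IsSupp L X (eval w l) s :=
  isSupp_iff.2 ⟨hw.1, isConcat_eval (isSuppVar_iff.1 hw).2.2 hl⟩

theorem isSuppVar_self (X : VarWordSeq α) (n : ℕ) : IsSuppVar L X (X.1 n) {n} :=
  isSuppVar_iff.2 ⟨Finset.singleton_nonempty n, X.2.1 n,
    isConcat_singleton.2 ⟨none, Finset.none_mem_insertNone, (evalVar_none _).symm⟩⟩

theorem isSupp_eval_self {n : ℕ} {l : α} (hl : l ∈ L n) : IsSupp L X (eval (X.1 n) l) {n} :=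
  (isSuppVar_self X n).eval (by simpa using hl)

theorem IsSupp.biUnion (hmono : Monotone L) {S : ℕ → Finset ℕ} (hS : IsBlock S)
    (hY : ∀ n, IsSuppVar L X (Y.1 n) (S n)) {w : List α} {s : Finset ℕ}
    (hw : IsSupp L Y w s) : IsSupp L X w (s.biUnion S) := by
  obtain ⟨hs, hw⟩ := isSupp_iff.1 hw
  refine isSupp_iff.2 ⟨hs.biUnion fun n _ => (hY n).1, hw.biUnion hS ?_⟩
  rintro n - _ ⟨l, hl, rfl⟩
  exact isConcat_eval (isSuppVar_iff.1 (hY n)).2.2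
    fun m hm => hmono (hS.le (fun n => (hY n).1) hm) hl

theorem IsSuppVar.biUnion (hmono : Monotone L) {S : ℕ → Finset ℕ} (hS : IsBlock S)
    (hY : ∀ n, IsSuppVar L X (Y.1 n) (S n)) {w : List (Option α)} {s : Finset ℕ}
    (hw : IsSuppVar L Y w s) : IsSuppVar L X w (s.biUnion S) := by
  obtain ⟨hs, hvar, hw⟩ := isSuppVar_iff.1 hw
  refine isSuppVar_iff.2 ⟨hs.biUnion fun n _ => (hY n).1, hvar, hw.biUnion hS ?_⟩
  rintro n - _ ⟨l, hl, rfl⟩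
  exact isConcat_evalVar (isSuppVar_iff.1 (hY n)).2.2 fun m hm =>
    Finset.insertNone.monotone (hmono (hS.le (fun n => (hY n).1) hm)) hl

theorem BlockLE.refl (X : VarWordSeq α) : BlockLE L X X :=
  ⟨fun n => {n}, isSuppVar_self X, isBlock_singleton strictMono_id⟩

theorem BlockLE.trans (hmono : Monotone L) (hZY : BlockLE L Z Y) (hYX : BlockLE L Y X) :
    BlockLE L Z X := by
  obtain ⟨T, hT, hTblock⟩ := hZY
  obtain ⟨S, hS, hSblock⟩ := hYX
  exact ⟨_, fun n => (hT n).biUnion hmono hSblock hS, IsBlock.biUnion hSblock hTblock⟩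

theorem BlockLE₀.trans (hmono : Monotone L) {A : WordSeq α} (hAY : BlockLE₀ L A Y)
    (hYX : BlockLE L Y X) : BlockLE₀ L A X := by
  obtain ⟨T, hT, hTblock⟩ := hAY
  obtain ⟨S, hS, hSblock⟩ := hYX
  exact ⟨_, fun n => (hT n).biUnion hmono hSblock hS, IsBlock.biUnion hSblock hTblock⟩

/-- The words of `[X]_L` with support in `{d, d + 1, …}`. -/
def tailWords (L : ℕ → Finset α) (X : VarWordSeq α) (d : ℕ) : Set (List α) :=
  tail (pieces L X) d

theorem mem_tailWords {w : List α} {d : ℕ} :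
    w ∈ tailWords L X d ↔ ∃ s, IsSupp L X w s ∧ ∀ j ∈ s, d ≤ j := by
  simp only [tailWords, tail, Set.mem_ofPred_eq, isSupp_iff]
  exact exists_congr fun s => by tauto

/-- The variable words of `[X]_{Lv}` with support in `{d, d + 1, …}`. -/
def tailVarWords (L : ℕ → Finset α) (X : VarWordSeq α) (d : ℕ) : Set (List (Option α)) :=
  {x ∈ tail (piecesVar L X) d | none ∈ x}

theorem mem_tailVarWords {x : List (Option α)} {d : ℕ} :
    x ∈ tailVarWords L X d ↔ ∃ s, IsSuppVar L X x s ∧ ∀ j ∈ s, d ≤ j := by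
  simp only [tailVarWords, tail, Set.mem_ofPred_eq, isSuppVar_iff]
  rw [← exists_and_right]
  exact exists_congr fun s => by tauto

end Supports

section BasicSets

variable {α : Type*} {L : ℕ → Finset α} {X Y Z : VarWordSeq α}

theorem initSeg_length {β : Type*} (x : ℕ → β) (n : ℕ) : (initSeg x n).length = n := by
  simp [initSeg]

theorem getElem_initSeg {β : Type*} (x : ℕ → β) (n i : ℕ) (h : i < (initSeg x n).length) :
    (initSeg x n)[i] = x i := by
  simp [initSeg]

theorem initSeg_succ {β : Type*} (x : ℕ → β) (n : ℕ) :
    initSeg x (n + 1) = initSeg x n ++ [x n] := by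
  simp [initSeg, List.range_succ]

theorem initSeg_eq_iff {β : Type*} {x : ℕ → β} {n : ℕ} {a : List β} :
    initSeg x n = a ↔ a.length = n ∧ ∀ i (h : i < a.length), a[i] = x i := by
  constructor
  · rintro rfl
    exact ⟨initSeg_length x n, fun i h => getElem_initSeg x n i h⟩
  · rintro ⟨rfl, h⟩
    refine List.ext_getElem (initSeg_length _ _) fun i _ hi => ?_
    rw [getElem_initSeg, h]

theorem initSeg_prepend {β : Type*} (a : List β) (w : ℕ → β) :
    initSeg (prepend a w) a.length = a :=
  initSeg_eq_iff.2 ⟨rfl, fun _ hi => (prepend_of_lt hi).symm⟩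

theorem prepend_initSeg {β : Type*} (x : ℕ → β) (n : ℕ) :
    prepend (initSeg x n) (fun i => x (n + i)) = x := by
  funext i
  rcases lt_or_ge i n with hi | hi
  · rw [prepend_of_lt (by rwa [initSeg_length]), getElem_initSeg]
  · obtain ⟨j, rfl⟩ := Nat.exists_eq_add_of_le hi
    simpa [initSeg_length] using prepend_length_add (initSeg x n) (fun i => x (n + i)) j

theorem initSeg_prefix {β : Type*} (x : ℕ → β) {m n : ℕ} (h : m ≤ n) :
    initSeg x m <+: initSeg x n := by
  obtain ⟨k, rfl⟩ := Nat.exists_eq_add_of_le h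
  rw [initSeg, initSeg, List.range_add, List.map_append]
  exact List.prefix_append _ _

theorem initSeg_of_prefix {β : Type*} {x : ℕ → β} {a b : List β} (hab : a <+: b)
    (hb : initSeg x b.length = b) : initSeg x a.length = a := by
  refine initSeg_eq_iff.2 ⟨rfl, fun i hi => ?_⟩
  rw [hab.getElem hi, (initSeg_eq_iff.1 hb).2]

theorem mem_basic {a : List (List α)} {A : WordSeq α} :
    A ∈ basic L a Y ↔ BlockLE₀ L A Y ∧ initSeg A.1 a.length = a := by
  refine and_congr_right fun _ => ⟨?_, fun h => ⟨_, h⟩⟩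
  rintro ⟨n, rfl⟩
  rw [initSeg_length]

theorem mem_basicVar {n : ℕ} :
    X ∈ basicVar L n Y ↔ BlockLE L X Y ∧ ∀ i < n, X.1 i = Y.1 i := by
  refine and_congr_right fun _ => ⟨?_, fun h => ⟨n, ?_⟩⟩
  · rintro ⟨m, h⟩ i hi
    rw [← initSeg_length Y.1 n] at hi
    rw [← (initSeg_eq_iff.1 h).2 i hi, getElem_initSeg]
  · refine initSeg_eq_iff.2 ⟨initSeg_length _ _, fun i hi => ?_⟩
    rw [getElem_initSeg, h i (by rwa [initSeg_length] at hi)]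

theorem mem_basicVar_self (n : ℕ) (X : VarWordSeq α) : X ∈ basicVar L n X :=
  mem_basicVar.2 ⟨.refl X, fun _ _ => rfl⟩

theorem basicVar_trans (hmono : Monotone L) {n : ℕ} (hZ : Z ∈ basicVar L n Y)
    (hY : Y ∈ basicVar L n X) : Z ∈ basicVar L n X := by
  rw [mem_basicVar] at *
  exact ⟨hZ.1.trans hmono hY.1, fun i hi => (hZ.2 i hi).trans (hY.2 i hi)⟩

theorem basicVar_antitone (X : VarWordSeq α) : Antitone fun n => basicVar L n X :=
  fun _ _ hmn _ hY => mem_basicVar.2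
    ⟨(mem_basicVar.1 hY).1, fun i hi => (mem_basicVar.1 hY).2 i (hi.trans_le hmn)⟩

theorem basic_subset_of_blockLE (hmono : Monotone L) (hXY : BlockLE L X Y)
    (a : List (List α)) : basic L a X ⊆ basic L a Y :=
  fun _ hA => ⟨hA.1.trans hmono hXY, hA.2⟩

theorem basic_subset_of_prefix {a b : List (List α)} (hab : a <+: b) :
    basic L b X ⊆ basic L a X :=
  fun _ hA => mem_basic.2 ⟨hA.1, initSeg_of_prefix hab (mem_basic.1 hA).2⟩

theorem FinLE₀.congr {a : List (List α)} {k : ℕ} (ha : FinLE₀ L a X k)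
    (hXY : ∀ i < k, X.1 i = Y.1 i) : FinLE₀ L a Y k := by
  obtain ⟨S, hS, hblock⟩ := ha
  refine ⟨S, fun n hn => ⟨?_, (hS n hn).2⟩, hblock⟩
  obtain ⟨⟨hne, l, hl, hw⟩, hSk⟩ := hS n hn
  exact ⟨hne, l, hl, hw.trans (cat_congr fun i hi => by rw [hXY i (Finset.mem_range.1 (hSk hi))])⟩

theorem FinLE₀.of_prefix {a b : List (List α)} {k : ℕ} (hab : a <+: b)
    (hb : FinLE₀ L b X k) : FinLE₀ L a X k := by
  obtain ⟨S, hS, hblock⟩ := hb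
  refine ⟨S, fun n hn => ?_, fun n m hnm hm => hblock n m hnm (hm.trans_le hab.length_le)⟩
  rw [hab.getElem hn]
  exact hS n (hn.trans_le hab.length_le)

theorem FinLE₀.depth_le {a : List (List α)} {k : ℕ} (ha : FinLE₀ L a X k) : depth L X a ≤ k :=
  Nat.sInf_le ha

theorem finLE₀_of_mem_basic {a : List (List α)} {A : WordSeq α} {S : ℕ → Finset ℕ} {k : ℕ}
    (hA : initSeg A.1 a.length = a) (hS : ∀ n, IsSupp L X (A.1 n) (S n)) (hblock : IsBlock S)
    (hk : ∀ n < a.length, S n ⊆ Finset.range k) : FinLE₀ L a X k :=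
  ⟨S, fun n hn => ⟨(initSeg_eq_iff.1 hA).2 n hn ▸ hS n, hk n hn⟩, fun n m hnm _ => hblock n m hnm⟩

theorem exists_finLE₀ {a : List (List α)} (ha : (basic L a X).Nonempty) :
    ∃ k, FinLE₀ L a X k := by
  obtain ⟨A, hA⟩ := ha
  obtain ⟨⟨S, hS, hblock⟩, hA⟩ := mem_basic.1 hA
  obtain ⟨k, hk⟩ := ((Finset.range a.length).biUnion S).exists_nat_subset_range
  exact ⟨k, finLE₀_of_mem_basic hA hS hblock fun n hn =>
    (Finset.subset_biUnion_of_mem S (Finset.mem_range.2 hn)).trans hk⟩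

theorem finLE₀_depth {a : List (List α)} (ha : (basic L a X).Nonempty) :
    FinLE₀ L a X (depth L X a) :=
  Nat.sInf_mem (exists_finLE₀ ha)

theorem depth_le_of_prefix {a b : List (List α)} (hab : a <+: b) (hb : (basic L b X).Nonempty) :
    depth L X a ≤ depth L X b :=
  ((finLE₀_depth hb).of_prefix hab).depth_le

theorem depth_congr {a : List (List α)} (ha : FinLE₀ L a X (depth L X a))
    (hXY : ∀ i < depth L X a, X.1 i = Y.1 i) : depth L Y a = depth L X a := by
  have hle := (ha.congr hXY).depth_le
  have haY : FinLE₀ L a Y (depth L Y a) :=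
    Nat.sInf_mem (s := {k | FinLE₀ L a Y k}) ⟨_, ha.congr hXY⟩
  exact hle.antisymm (haY.congr fun i hi => (hXY i (hi.trans_le hle)).symm).depth_le

theorem IsBlockSeq.rapidlyIncreasing {d : ℕ} {w : ℕ → List α}
    (hw : IsBlockSeq (IsSupp L X) d w) : RapidlyIncreasing w := by
  obtain ⟨S, hblock, hS⟩ := hw
  exact X.2.2.of_isBlock hblock (fun n => (hS n).1.1) fun n => (hS n).1.length

theorem isBlockSeq_of_mem_basic {a : List (List α)} {A : WordSeq α} (hA : A ∈ basic L a X) :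
    IsBlockSeq (IsSupp L X) (depth L X a) fun i => A.1 (a.length + i) := by
  obtain ⟨⟨S, hS, hblock⟩, hA⟩ := mem_basic.1 hA
  refine ⟨fun i => S (a.length + i), fun n m hnm => hblock _ _ (by omega),
    fun i => ⟨hS _, fun j hj => (finLE₀_of_mem_basic hA hS hblock fun n hn k hk => ?_).depth_le⟩⟩
  exact Finset.mem_range.2 (hblock n (a.length + i) (by omega) k hk j hj)

theorem FinLE₀.mem_basic {a : List (List α)} {d : ℕ} (ha : FinLE₀ L a X d) {A : WordSeq α}
    (hA : initSeg A.1 a.length = a)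
    (hw : IsBlockSeq (IsSupp L X) d fun i => A.1 (a.length + i)) : A ∈ basic L a X := by
  obtain ⟨S, hblock, hS⟩ := IsFinBlockSeq.prepend ha hw
  have hprepend : prepend a (fun i => A.1 (a.length + i)) = A.1 := by
    simpa only [hA] using prepend_initSeg A.1 a.length
  exact ⟨⟨S, fun n => hprepend ▸ (hS n).1, hblock⟩, _, hA⟩

theorem FinLE₀.exists_mem_basic {a : List (List α)} {d : ℕ} (ha : FinLE₀ L a X d)
    {w : ℕ → List α} (hw : IsBlockSeq (IsSupp L X) d w) :
    ∃ A ∈ basic L a X, ∀ i, A.1 (a.length + i) = w i :=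
  ⟨⟨prepend a w, (IsFinBlockSeq.prepend ha hw).rapidlyIncreasing⟩,
    ha.mem_basic (initSeg_prepend a w) (by simpa only [prepend_length_add] using hw),
    prepend_length_add a w⟩

theorem isBlockSeq_eval (hmono : Monotone L) {l : α} {d n : ℕ} (hl : l ∈ L n) (hdn : d ≤ n) :
    IsBlockSeq (IsSupp L X) d fun i => eval (X.1 (n + i)) l :=
  isBlockSeq_of_strictMono (φ := (n + ·)) (fun _ _ h => Nat.add_lt_add_left h n)
    (fun _ => isSupp_eval_self (hmono (Nat.le_add_right _ _) hl)) fun _ => by omega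

theorem FinLE₀.basic_nonempty (hmono : Monotone L) {l : α} {n : ℕ} (hl : l ∈ L n)
    {a : List (List α)} {d : ℕ} (ha : FinLE₀ L a X d) : (basic L a X).Nonempty := by
  obtain ⟨A, hA, -⟩ := ha.exists_mem_basic (isBlockSeq_eval hmono
    (hmono (le_max_right d n) hl) (le_max_left d n))
  exact ⟨A, hA⟩

theorem exists_letter {a : List (List α)} (ha : (basic L a X).Nonempty) :
    ∃ n, ∃ l, l ∈ L n := by
  obtain ⟨A, ⟨S, hS, -⟩, -⟩ := ha
  obtain ⟨⟨n, hn⟩, l, hl, -⟩ := hS 0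
  exact ⟨n, l n, hl n hn⟩

theorem basic_nonempty_of_mem_basicVar (hmono : Monotone L) {a : List (List α)}
    (ha : (basic L a X).Nonempty) (hY : Y ∈ basicVar L (depth L X a) X) :
    (basic L a Y).Nonempty := by
  obtain ⟨n, l, hl⟩ := exists_letter ha
  exact ((finLE₀_depth ha).congr fun i hi =>
    ((mem_basicVar.1 hY).2 i hi).symm).basic_nonempty hmono hl

theorem depth_eq_of_mem_basicVar {a : List (List α)} (ha : (basic L a X).Nonempty)
    (hY : Y ∈ basicVar L (depth L X a) X) : depth L Y a = depth L X a :=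
  depth_congr (finLE₀_depth ha) fun i hi => ((mem_basicVar.1 hY).2 i hi).symm

theorem mem_basic_concat {a : List (List α)} {A : WordSeq α} (hA : A ∈ basic L a X) :
    A ∈ basic L (a ++ [A.1 a.length]) X :=
  ⟨hA.1, a.length + 1, by rw [initSeg_succ, (mem_basic.1 hA).2]⟩

theorem mem_tailWords_of_mem_basic {a : List (List α)} {A : WordSeq α}
    (hA : A ∈ basic L a X) : A.1 a.length ∈ tailWords L X (depth L X a) := by
  obtain ⟨S, -, hS⟩ := isBlockSeq_of_mem_basic hA
  exact mem_tailWords.2 ⟨S 0, hS 0⟩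

theorem basic_concat_nonempty_iff (hmono : Monotone L) {a : List (List α)} {w : List α}
    (ha : (basic L a X).Nonempty) :
    (basic L (a ++ [w]) X).Nonempty ↔ w ∈ tailWords L X (depth L X a) := by
  constructor
  · rintro ⟨A, hA⟩
    have hw : w = A.1 a.length := by
      simpa using (initSeg_eq_iff.1 (mem_basic.1 hA).2).2 a.length (by simp)
    exact hw ▸ mem_tailWords_of_mem_basic (basic_subset_of_prefix (List.prefix_append a [w]) hA)
  · intro hw
    obtain ⟨s, hws, hs⟩ := mem_tailWords.1 hw
    obtain ⟨n, l, hl⟩ := exists_letter ha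
    obtain ⟨k, hk⟩ := (s ∪ {n, depth L X a}).exists_nat_subset_range
    have hlt : ∀ i ∈ s ∪ {n, depth L X a}, i < k := fun i hi => Finset.mem_range.1 (hk hi)
    obtain ⟨A, hA, hAw⟩ := (finLE₀_depth ha).exists_mem_basic <|
      (isBlockSeq_eval (X := X) hmono (hmono (hlt n (by simp)).le hl) le_rfl).cons hws hs
        (fun j hj => hlt j (Finset.mem_union_left _ hj)) (hlt _ (by simp)).le
    have hw : A.1 a.length = w := hAw 0
    exact ⟨A, hw ▸ mem_basic_concat hA⟩

theorem exists_mem_basicVar {d : ℕ} {z : ℕ → List (Option α)}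
    (hz : IsBlockSeq (IsSuppVar L X) d z) : ∃ Y ∈ basicVar L d X, ∀ i, Y.1 (d + i) = z i := by
  have hX : IsFinBlockSeq (IsSuppVar L X) d (initSeg X.1 d) := by
    refine ⟨fun n => {n}, fun n hn => ⟨?_, ?_⟩,
      fun n m hnm _ => isBlock_singleton strictMono_id n m hnm⟩
    · exact getElem_initSeg X.1 d n hn ▸ isSuppVar_self X n
    · simpa [initSeg_length] using hn
  obtain ⟨S, hblock, hS⟩ := hX.prepend hz
  have hinit := initSeg_prepend (initSeg X.1 d) z
  rw [initSeg_length] at hinit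
  refine ⟨⟨prepend (initSeg X.1 d) z, fun n => (hS n).1.2.1, X.2.2.of_isBlock hblock
    (fun n => (hS n).1.1) fun n => (hS n).1.length⟩,
    ⟨⟨S, fun n => (hS n).1, hblock⟩, d, hinit⟩, fun i => ?_⟩
  simpa only [initSeg_length] using prepend_length_add (initSeg X.1 d) z i

end BasicSets

section Amalgamation

variable {α : Type*} {L : ℕ → Finset α} {X Y Z : VarWordSeq α}

theorem eq_elim_of_getD_eq {l m p q : α} (hlm : l ≠ m) {c e o : Option α} (hp : o.getD l = p)
    (hq : o.getD m = q) (hl : c.getD l = e.getD p) (hm : c.getD m = e.getD q) :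
    c = e.elim o some := by
  cases c <;> cases e <;> cases o <;> simp_all

theorem exists_eq_evalVar {x y : List (Option α)} (hx : none ∈ x) {l m p q : α} (hlm : l ≠ m)
    (hl : eval y l = eval x p) (hm : eval y m = eval x q) :
    ∃ o : Option α, o.getD l = p ∧ y = evalVar x o := by
  have hlength : y.length = x.length := by rw [← length_eval y l, hl, length_eval]
  have hgetD : ∀ {k r}, eval y k = eval x r → ∀ i (hy : i < y.length) (hx : i < x.length),
      y[i].getD k = x[i].getD r := fun {k r} h i hy _ => by
    simpa [eval] using List.getElem_of_eq h (i := i) (by rwa [length_eval])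
  obtain ⟨i, hi, hxi⟩ := List.mem_iff_getElem.1 hx
  have hpi := hgetD hl i (hlength ▸ hi) hi
  have hqi := hgetD hm i (hlength ▸ hi) hi
  rw [hxi] at hpi hqi
  refine ⟨_, hpi, List.ext_getElem (by rw [length_evalVar, hlength]) fun j hj _ => ?_⟩
  simp only [evalVar, List.getElem_map]
  exact eq_elim_of_getD_eq hlm hpi hqi (hgetD hl j hj (hlength ▸ hj))
    (hgetD hm j hj (hlength ▸ hj))

theorem isConcat_piecesVar_of_eval {l m : α} (hlm : l ≠ m) {y : List (Option α)} {s : Finset ℕ}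
    (hl : IsConcat (pieces L X) (eval y l) s) (hm : IsConcat (pieces L X) (eval y m) s) :
    IsConcat (piecesVar L X) y s := by
  induction s using Finset.induction_on_max generalizing y with
  | empty => simpa [isConcat_empty, eval] using hl
  | insert k s hk ih =>
    obtain ⟨u, hu, _, ⟨p, hp, rfl⟩, hlu⟩ := (isConcat_insert hk).1 hl
    obtain ⟨u', hu', _, ⟨q, -, rfl⟩, hmu⟩ := (isConcat_insert hk).1 hm
    obtain ⟨y, z, rfl, rfl, hz⟩ := List.map_eq_append_iff.1 hlu
    have hzlength : (z.map fun c => c.getD m).length = (eval (X.1 k) q).length := by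
      rw [length_eval, List.length_map, ← length_eval (X.1 k) p, ← hz, List.length_map]
    rw [eval, List.map_append] at hmu
    obtain ⟨rfl, hz'⟩ := List.append_inj' hmu hzlength
    obtain ⟨o, ho, rfl⟩ := exists_eq_evalVar (X.2.1 k) hlm hz hz'
    refine (isConcat_insert hk).2 ⟨y, ih hu hu', _, ⟨o, ?_, rfl⟩, rfl⟩
    cases o with
    | none => exact Finset.none_mem_insertNone
    | some c => simpa [← ho] using hp

theorem exists_isSuppVar_eval_eq {l m : α} (hlm : l ≠ m ∨ Subsingleton α)
    {y : List (Option α)} (hy : none ∈ y) {s : Finset ℕ} (hl : IsSupp L X (eval y l) s)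
    (hm : IsSupp L X (eval y m) s) :
    ∃ z, IsSuppVar L X z s ∧ ∀ k, eval z k = eval y k := by
  obtain ⟨hs, hl'⟩ := isSupp_iff.1 hl
  rcases hlm with hlm | hα
  · exact ⟨y, isSuppVar_iff.2 ⟨hs, hy, isConcat_piecesVar_of_eval hlm hl' (isSupp_iff.1 hm).2⟩,
      fun _ => rfl⟩
  · have hX : IsConcat (piecesVar L X) (cat X.1 s) s :=
      ⟨X.1, fun n _ => ⟨none, Finset.none_mem_insertNone, (evalVar_none _).symm⟩, rfl⟩
    obtain ⟨n, hn⟩ := id hs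
    have hXnone : none ∈ cat X.1 s :=
      List.mem_flatMap.2 ⟨n, (Finset.mem_sort _).2 hn, X.2.1 n⟩
    have hXs : IsSuppVar L X (cat X.1 s) s := isSuppVar_iff.2 ⟨hs, hXnone, hX⟩
    refine ⟨_, hXs, fun k => List.ext_getElem ?_ fun _ _ _ => Subsingleton.elim _ _⟩
    rw [length_eval, length_eval, ← length_eval y l, hXs.length, hl.length]

theorem exists_two_letters (hmono : Monotone L) (hcover : ∀ l : α, ∃ n, l ∈ L n) (l₀ : α) :
    ∃ n, ∃ l ∈ L n, ∃ m ∈ L n, l ≠ m ∨ Subsingleton α := by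
  rcases subsingleton_or_nontrivial α with h | ⟨l, m, hlm⟩
  · obtain ⟨n, hn⟩ := hcover l₀
    exact ⟨n, l₀, hn, l₀, hn, .inr h⟩
  · obtain ⟨i, hi⟩ := hcover l
    obtain ⟨j, hj⟩ := hcover m
    exact ⟨max i j, l, hmono (le_max_left _ _) hi, m, hmono (le_max_right _ _) hj, .inl hlm⟩

theorem isBlockSeq_eval_of_basic_subset (hmono : Monotone L) {b : List (List α)}
    (hZ : (basic L b Z).Nonempty) (hZX : basic L b Z ⊆ basic L b X) {l : α} {N : ℕ}
    (hl : l ∈ L N) (hN : depth L Z b ≤ N) :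
    IsBlockSeq (IsSupp L X) (depth L X b) fun i => eval (Z.1 (N + i)) l := by
  obtain ⟨A, hA, hAl⟩ := (finLE₀_depth hZ).exists_mem_basic (isBlockSeq_eval hmono hl hN)
  simpa only [hAl] using isBlockSeq_of_mem_basic (hZX hA)

theorem exists_isBlockSeq_eval_eq (hmono : Monotone L) (hcover : ∀ l : α, ∃ n, l ∈ L n)
    {b : List (List α)} (hZ : (basic L b Z).Nonempty) (hZX : basic L b Z ⊆ basic L b X) :
    ∃ N, depth L X b ≤ N ∧ depth L Z b ≤ N ∧ ∃ z, IsBlockSeq (IsSuppVar L X) (depth L X b) z ∧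
      ∀ i k, eval (z i) k = eval (Z.1 (N + i)) k := by
  obtain ⟨-, l₀, -⟩ := exists_letter hZ
  obtain ⟨n, l, hl, m, hm, hlm⟩ := exists_two_letters hmono hcover l₀
  obtain ⟨N, hXN, hZN, hnN⟩ : ∃ N, depth L X b ≤ N ∧ depth L Z b ≤ N ∧ n ≤ N :=
    ⟨depth L X b + depth L Z b + n, by omega, by omega, by omega⟩
  obtain ⟨S, hblock, hS⟩ := isBlockSeq_eval_of_basic_subset hmono hZ hZX (hmono hnN hl) hZN
  obtain ⟨S', -, hS'⟩ := isBlockSeq_eval_of_basic_subset hmono hZ hZX (hmono hnN hm) hZN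
  have hSS' : ∀ i, S' i = S i := fun i => X.2.2.finset_eq' <| by
    rw [← (hS i).1.length, ← (hS' i).1.length, length_eval, length_eval]
  choose z hzS hz using fun i => exists_isSuppVar_eval_eq hlm (Z.2.1 (N + i)) (hS i).1
    (hSS' i ▸ (hS' i).1)
  exact ⟨N, hXN, hZN, z, ⟨S, hblock, fun i => ⟨hzS i, (hS i).2⟩⟩, hz⟩

theorem IsSupp.image_add (hmono : Monotone L) {d c : ℕ}
    (hYZ : ∀ i, d ≤ i → ∀ k, eval (Y.1 i) k = eval (Z.1 (i + c)) k) {w : List α} {s : Finset ℕ}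
    (hw : IsSupp L Y w s) (hds : ∀ j ∈ s, d ≤ j) : IsSupp L Z w (s.image (· + c)) := by
  obtain ⟨hs, hw⟩ := isSupp_iff.1 hw
  rw [← Finset.biUnion_singleton]
  refine isSupp_iff.2 ⟨hs.biUnion fun n _ => Finset.singleton_nonempty _,
    hw.biUnion (isBlock_singleton fun _ _ h => Nat.add_lt_add_right h c) ?_⟩
  rintro n hn _ ⟨l, hl, rfl⟩
  exact isConcat_singleton.2 ⟨l, hmono (Nat.le_add_right n c) hl, hYZ n (hds n hn) l⟩

theorem exists_mem_basicVar_basic_subset (hmono : Monotone L) (hcover : ∀ l : α, ∃ n, l ∈ L n)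
    {b : List (List α)} (hZ : (basic L b Z).Nonempty) (hZX : basic L b Z ⊆ basic L b X) :
    ∃ Y ∈ basicVar L (depth L X b) X, basic L b Y ⊆ basic L b Z := by
  obtain ⟨N, hXN, hZN, z, hz, hzZ⟩ := exists_isBlockSeq_eval_eq hmono hcover hZ hZX
  obtain ⟨Y, hY, hYz⟩ := exists_mem_basicVar hz
  obtain ⟨c, rfl⟩ := Nat.exists_eq_add_of_le hXN
  have hYZ : ∀ i, depth L X b ≤ i → ∀ k, eval (Y.1 i) k = eval (Z.1 (i + c)) k := by
    intro i hi k
    obtain ⟨j, rfl⟩ := Nat.exists_eq_add_of_le hi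
    rw [hYz, hzZ, Nat.add_right_comm]
  refine ⟨Y, hY, fun A hA => ?_⟩
  obtain ⟨T, hblock, hT⟩ := isBlockSeq_of_mem_basic hA
  rw [depth_eq_of_mem_basicVar (hZ.mono hZX) hY] at hT
  refine (finLE₀_depth hZ).mem_basic (mem_basic.1 hA).2
    ⟨fun i => (T i).image (· + c), ?_, fun i => ⟨(hT i).1.image_add hmono hYZ (hT i).2, ?_⟩⟩
  · intro n m hnm
    simpa only [Finset.forall_mem_image, Nat.add_lt_add_iff_right] using hblock n m hnm
  · rw [Finset.forall_mem_image]
    exact fun j hj => hZN.trans (Nat.add_le_add_right ((hT i).2 j hj) c)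

end Amalgamation

section Finiteness

variable {α : Type*} {L : ℕ → Finset α} {X : VarWordSeq α}

theorem finite_setOf_isSupp (N : ℕ) :
    {w | ∃ s ⊆ Finset.range N, IsSupp L X w s}.Finite := by
  have hpieces : ∀ n, (pieces L X n).Finite := fun n =>
    ((L n).finite_toSet.image (eval (X.1 n))).subset fun w ⟨l, hl, hw⟩ => ⟨l, hl, hw.symm⟩
  refine ((Finset.range N).powerset.finite_toSet.biUnion fun s _ =>
    finite_setOf_isConcat (s := s) fun n _ => hpieces n).subset fun w ⟨s, hs, hw⟩ => ?_
  exact Set.mem_biUnion (Finset.mem_coe.2 (Finset.mem_powerset.2 hs)) (isSupp_iff.1 hw).2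

theorem FinLE₀.length_le {a : List (List α)} {N : ℕ} (ha : FinLE₀ L a X N) : a.length ≤ N := by
  obtain ⟨S, hS, hblock⟩ := ha
  by_contra! hN
  obtain ⟨i, hi⟩ := (hS N hN).1.1
  exact (Finset.mem_range.1 ((hS N hN).2 hi)).not_ge
    (le_of_mem_of_block (fun n hn => (hS n hn).1.1) hblock hN hi)

theorem finite_setOf_finLE₀ (N : ℕ) : {a : List (List α) | FinLE₀ L a X N}.Finite := by
  set W : Set (List α) := {w | ∃ s ⊆ Finset.range N, IsSupp L X w s}
  have : Finite W := finite_setOf_isSupp N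
  refine ((List.finite_length_le W N).image (List.map Subtype.val)).subset fun a ha => ?_
  obtain ⟨S, hS, -⟩ := id ha
  have haW : ∀ w ∈ a, w ∈ W := by
    intro w hw
    obtain ⟨n, hn, rfl⟩ := List.mem_iff_getElem.1 hw
    exact ⟨S n, (hS n hn).2, (hS n hn).1⟩
  lift a to List W using haW
  exact ⟨a, by simpa using FinLE₀.length_le ha, rfl⟩

end Finiteness

section CompactSemigroups

variable {S T : Type*} [Semigroup S] [TopologicalSpace S] [CompactSpace S]
  [Semigroup T] [TopologicalSpace T] [CompactSpace T] [T2Space T]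

/-- The nonempty closed left ideals of a subsemigroup `D` of a topological semigroup. -/
structure IsClosedLeftIdeal (D J : Set S) : Prop where
  subset : J ⊆ D
  isClosed : IsClosed J
  nonempty : J.Nonempty
  mul_mem : ∀ x ∈ D, ∀ y ∈ J, x * y ∈ J

theorem exists_minimal_isClosedLeftIdeal {D : Set S} (hD : IsClosedLeftIdeal D D) :
    ∃ J, Minimal (IsClosedLeftIdeal D) J := by
  refine zorn_superset {J | IsClosedLeftIdeal D J} fun c hcs hc => ?_
  rcases c.eq_empty_or_nonempty with rfl | hcne
  · exact ⟨D, hD, fun J hJ => hJ.elim⟩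
  refine ⟨⋂₀ c, ⟨?_, isClosed_sInter fun K hK => (hcs hK).isClosed, ?_, ?_⟩,
    fun K hK => Set.sInter_subset_of_mem hK⟩
  · obtain ⟨K, hK⟩ := hcne
    exact (Set.sInter_subset_of_mem hK).trans (hcs hK).subset
  · have := hcne.coe_sort
    rw [Set.sInter_eq_iInter]
    exact IsCompact.nonempty_iInter_of_directed_nonempty_isCompact_isClosed _
      (DirectedOn.directed_val (IsChain.directedOn hc.symm)) (fun K => (hcs K.2).nonempty)
      (fun K => (hcs K.2).isClosed.isCompact) fun K => (hcs K.2).isClosed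
  · exact fun x hx y hy K hK => (hcs hK).mul_mem x hx y (hy K hK)

variable [T2Space S]

theorem IsClosedLeftIdeal.image_mul_right (hS : ∀ r : S, Continuous (· * r)) {D J : Set S}
    (hD : IsClosedLeftIdeal D D) (hJ : IsClosedLeftIdeal D J) {e : S} (he : e ∈ J) :
    IsClosedLeftIdeal D ((· * e) '' D) where
  subset := Set.image_subset_iff.2 fun x hx => hJ.subset (hJ.mul_mem x hx e he)
  isClosed := (hD.isClosed.isCompact.image (hS e)).isClosed
  nonempty := hD.nonempty.image _
  mul_mem := by
    rintro x hx _ ⟨y, hy, rfl⟩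
    exact ⟨x * y, hD.mul_mem x hx y hy, mul_assoc x y e⟩

theorem eq_of_idempotent_of_minimal (hS : ∀ r : S, Continuous (· * r)) {D J : Set S}
    (hD : IsClosedLeftIdeal D D) (hJ : Minimal (IsClosedLeftIdeal D) J) {u e : S} (hu : u ∈ J)
    (he : e ∈ J) (hee : e * e = e) (hue : u * e = e) : e = u := by
  have hsubset : (· * e) '' D ⊆ J :=
    Set.image_subset_iff.2 fun x hx => hJ.prop.mul_mem x hx e he
  obtain ⟨z, -, rfl⟩ := hJ.le_of_le (hD.image_mul_right hS hJ.prop he) hsubset hu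
  simpa only [mul_assoc, hee] using hue.symm

/-- If `u` is an idempotent of a minimal left ideal of `D` and `w` is an idempotent of `E * ι u`,
then `u * τ i w` is an idempotent of that ideal which is absorbed by `u`, hence equal to `u`; this
says that `ι u * w` is mapped to `u` by every retraction `τ i`. -/
theorem exists_idempotent_retractions_eq {I : Type*} (hS : ∀ r : S, Continuous (· * r))
    (hT : ∀ r : T, Continuous (· * r)) {D : Set S} {E : Set T} {ι : S →ₙ* T} {τ : I → T →ₙ* S}
    (hD : IsClosedLeftIdeal D D) (hE : IsClosedLeftIdeal E E)
    (hDE : ∀ x ∈ D, ∀ y ∈ E, ι x * y ∈ E) (hED : ∀ x ∈ E, ∀ y ∈ D, x * ι y ∈ E)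
    (hτι : ∀ i x, τ i (ι x) = x) (hτ : ∀ i, ∀ y ∈ E, τ i y ∈ D) :
    ∃ u ∈ D, u * u = u ∧ ∃ v ∈ E, ∀ i, τ i v = u := by
  obtain ⟨J, hJ⟩ := exists_minimal_isClosedLeftIdeal hD
  have hJD := hJ.prop.subset
  obtain ⟨u, huJ, huu⟩ := exists_idempotent_in_compact_subsemigroup hS J hJ.prop.nonempty
    hJ.prop.isClosed.isCompact fun x hx y hy => hJ.prop.mul_mem x (hJD hx) y hy
  obtain ⟨_, ⟨y, hy, rfl⟩, hww⟩ := exists_idempotent_in_compact_subsemigroup hT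
    ((· * ι u) '' E) (hE.nonempty.image _) (hE.isClosed.isCompact.image (hT _)) (by
      rintro _ ⟨x, hx, rfl⟩ _ ⟨y, hy, rfl⟩
      exact ⟨x * ι u * y, hE.mul_mem _ (hED x hx u (hJD huJ)) y hy, mul_assoc _ _ _⟩)
  refine ⟨u, hJD huJ, huu, ι u * (y * ι u), hDE u (hJD huJ) _ (hED y hy u (hJD huJ)),
    fun i => ?_⟩
  have hτyu : τ i y * u * (τ i y * u) = τ i y * u := by
    simpa only [map_mul, hτι] using congrArg (τ i) hww
  have hmem : τ i y * u ∈ J := hJ.prop.mul_mem _ (hτ i y hy) u huJ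
  rw [map_mul, map_mul, hτι]
  refine eq_of_idempotent_of_minimal hS hD hJ huJ (hJ.prop.mul_mem u (hJD huJ) _ hmem) ?_ ?_
  · rw [mul_assoc, ← mul_assoc (τ i y * u), mul_assoc (τ i y), huu, hτyu]
  · rw [← mul_assoc, huu]

end CompactSemigroups

section Ultrafilters

open Filter

attribute [local instance] Ultrafilter.semigroup

variable {M N : Type*} [Semigroup M] [Semigroup N]

/-- The homomorphism of ultrafilter semigroups that a semigroup homomorphism induces. -/
def ultrafilterMap (f : M →ₙ* N) : Ultrafilter M →ₙ* Ultrafilter N where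
  toFun := Ultrafilter.map f
  map_mul' U V := Ultrafilter.coe_inj.1 <| Filter.ext' fun p => by
    simp only [Ultrafilter.eventually_mul, Ultrafilter.coe_map, eventually_map, map_mul]

/-- The ultrafilters that contain all members of a sequence of sets. -/
def ultrafiltersOn {β : Type*} (P : ℕ → Set β) : Set (Ultrafilter β) :=
  {U | ∀ m, P m ∈ U}

theorem isClosed_ultrafiltersOn {β : Type*} (P : ℕ → Set β) : IsClosed (ultrafiltersOn P) := by
  rw [ultrafiltersOn, Set.ofPred_forall]
  exact isClosed_iInter fun m => ultrafilter_isClosed_basic (P m)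

theorem nonempty_ultrafiltersOn {β : Type*} {P : ℕ → Set β} {x : ℕ → β}
    (hx : ∀ m, ∀ᶠ i in atTop, x i ∈ P m) : (ultrafiltersOn P).Nonempty :=
  ⟨(hyperfilter ℕ).map x, fun m => (hx m).filter_mono Nat.hyperfilter_le_atTop⟩

theorem mul_mem_ultrafiltersOn {P Q R : ℕ → Set M}
    (h : ∀ m, ∀ x ∈ P m, ∃ k, ∀ y ∈ Q k, x * y ∈ R m) {U V : Ultrafilter M}
    (hU : U ∈ ultrafiltersOn P) (hV : V ∈ ultrafiltersOn Q) : U * V ∈ ultrafiltersOn R :=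
  fun m => (Ultrafilter.eventually_mul U V (· ∈ R m)).2 <| mem_of_superset (hU m) fun x hx =>
    let ⟨k, hk⟩ := h m x hx
    mem_of_superset (hV k) hk

theorem ultrafilterMap_mem_ultrafiltersOn {P : ℕ → Set M} {Q : ℕ → Set N} {f : M →ₙ* N}
    (h : ∀ m, ∃ k, ∀ x ∈ P k, f x ∈ Q m) {U : Ultrafilter M} (hU : U ∈ ultrafiltersOn P) :
    ultrafilterMap f U ∈ ultrafiltersOn Q :=
  fun m => let ⟨k, hk⟩ := h m
    Ultrafilter.mem_map.2 (mem_of_superset (hU k) hk)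

variable {α : Type*} {L : ℕ → Finset α}

theorem map_some_mem_tail_piecesVar {X : VarWordSeq α} {w : List α} {m : ℕ}
    (hw : w ∈ tailWords L X m) : w.map some ∈ tail (piecesVar L X) m := by
  obtain ⟨s, hs, hsm, hws⟩ := hw
  refine ⟨s, hs, hsm, hws.map some ?_⟩
  rintro n - _ ⟨l, hl, rfl⟩
  exact ⟨some l, by simpa using hl, map_some_eval _ _⟩

theorem eval_mem_tailWords (hmono : Monotone L) {X : VarWordSeq α} {x : List (Option α)} {m : ℕ}
    {l : α} (hl : l ∈ L m) (hx : x ∈ tailVarWords L X m) : eval x l ∈ tailWords L X m := by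
  obtain ⟨s, hx, hs⟩ := mem_tailVarWords.1 hx
  exact mem_tailWords.2 ⟨s, hx.eval fun n hn => hmono (hs n hn) hl, hs⟩

theorem exists_append_mem_tailVarWords_left {X : VarWordSeq α} {m : ℕ} {x : List (Option α)}
    (hx : x ∈ tailVarWords L X m) :
    ∃ k, ∀ y ∈ tail (piecesVar L X) k, x ++ y ∈ tailVarWords L X m := by
  obtain ⟨k, hk⟩ := exists_append_mem_tail hx.1
  exact ⟨k, fun y hy => ⟨hk y hy, List.mem_append_left _ hx.2⟩⟩

theorem exists_append_mem_tailVarWords_right {X : VarWordSeq α} {m : ℕ} {x : List (Option α)}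
    (hx : x ∈ tail (piecesVar L X) m) :
    ∃ k, ∀ y ∈ tailVarWords L X k, x ++ y ∈ tailVarWords L X m := by
  obtain ⟨k, hk⟩ := exists_append_mem_tail hx
  exact ⟨k, fun y hy => ⟨hk y hy.1, List.mem_append_right _ hy.2⟩⟩

theorem isClosedLeftIdeal_ultrafiltersOn_tailWords (hmono : Monotone L) (X : VarWordSeq α)
    {n : ℕ} {l : α} (hl : l ∈ L n) :
    IsClosedLeftIdeal (S := Ultrafilter (FreeMonoid α)) (ultrafiltersOn (tailWords L X))
      (ultrafiltersOn (tailWords L X)) where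
  subset := subset_rfl
  isClosed := isClosed_ultrafiltersOn _
  nonempty := by
    refine nonempty_ultrafiltersOn (x := fun i => eval (X.1 i) l) fun m => ?_
    filter_upwards [eventually_ge_atTop (max m n)] with i hi
    exact mem_tailWords.2 ⟨{i}, isSupp_eval_self (hmono (le_of_max_le_right hi) hl),
      by simpa using le_of_max_le_left hi⟩
  mul_mem _ hU _ hV := mul_mem_ultrafiltersOn (M := FreeMonoid α)
    (fun _ _ hw => exists_append_mem_tail hw) hU hV

theorem isClosedLeftIdeal_ultrafiltersOn_tailVarWords (L : ℕ → Finset α) (X : VarWordSeq α) :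
    IsClosedLeftIdeal (S := Ultrafilter (FreeMonoid (Option α)))
      (ultrafiltersOn (tailVarWords L X)) (ultrafiltersOn (tailVarWords L X)) where
  subset := subset_rfl
  isClosed := isClosed_ultrafiltersOn _
  nonempty := by
    refine nonempty_ultrafiltersOn (x := X.1) fun m => ?_
    filter_upwards [eventually_ge_atTop m] with i hi
    exact mem_tailVarWords.2 ⟨{i}, isSuppVar_self X i, by simpa using hi⟩
  mul_mem _ hU _ hV := mul_mem_ultrafiltersOn (M := FreeMonoid (Option α))
    (fun _ _ hx => (exists_append_mem_tailVarWords_left hx).imp fun _ hk y hy => hk y hy.1) hU hV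

theorem exists_idempotent_ultrafilter (hmono : Monotone L) (hcover : ∀ l : α, ∃ n, l ∈ L n) (l₀ : α)
    (X : VarWordSeq α) :
    ∃ (u : Ultrafilter (List α)) (v : Ultrafilter (List (Option α))),
      (∀ p : List α → Prop, (∀ᶠ w in u, p w) ↔ ∀ᶠ w in u, ∀ᶠ w' in u, p (w ++ w')) ∧
      (∀ m, tailWords L X m ∈ u) ∧ (∀ m, tailVarWords L X m ∈ v) ∧
      ∀ l, v.map (eval · l) = u := by
  let ι : FreeMonoid α →ₙ* FreeMonoid (Option α) := (FreeMonoid.map some).toMulHom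
  let τ : α → FreeMonoid (Option α) →ₙ* FreeMonoid α :=
    fun l => (FreeMonoid.map (·.getD l)).toMulHom
  have hι : ∀ U ∈ ultrafiltersOn (tailWords L X),
      ultrafilterMap ι U ∈ ultrafiltersOn (tail (piecesVar L X)) := fun U hU =>
    ultrafilterMap_mem_ultrafiltersOn (f := ι)
      (fun m => ⟨m, fun _ => map_some_mem_tail_piecesVar⟩) hU
  have hτι : ∀ l U, ultrafilterMap (τ l) (ultrafilterMap ι U) = U := fun l U => by
    have hid : τ l ∘ ι = id := funext fun w => (List.map_map ..).trans (List.map_id w)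
    exact (Ultrafilter.map_map U ι (τ l)).trans (hid ▸ U.map_id)
  have hτ : ∀ l, ∀ V ∈ ultrafiltersOn (tailVarWords L X),
      ultrafilterMap (τ l) V ∈ ultrafiltersOn (tailWords L X) := fun l V hV => by
    obtain ⟨n, hn⟩ := hcover l
    exact ultrafilterMap_mem_ultrafiltersOn (f := τ l) (fun m => ⟨max m n, fun x hx =>
      tail_antitone _ (le_max_left m n)
        (eval_mem_tailWords hmono (hmono (le_max_right m n) hn) hx)⟩) hV
  obtain ⟨n₀, hn₀⟩ := hcover l₀
  obtain ⟨u, hu, huu, v, hv, hτv⟩ := exists_idempotent_retractions_eq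
    (ι := ultrafilterMap ι) (τ := fun l => ultrafilterMap (τ l))
    Ultrafilter.continuous_mul_left Ultrafilter.continuous_mul_left
    (isClosedLeftIdeal_ultrafiltersOn_tailWords hmono X hn₀)
    (isClosedLeftIdeal_ultrafiltersOn_tailVarWords L X)
    (fun U hU V hV => mul_mem_ultrafiltersOn (M := FreeMonoid (Option α))
      (fun _ _ => exists_append_mem_tailVarWords_right) (hι U hU) hV)
    (fun U hU V hV => mul_mem_ultrafiltersOn (M := FreeMonoid (Option α))
      (fun _ _ => exists_append_mem_tailVarWords_left) hU (hι V hV))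
    hτι hτ
  have huu' := Ultrafilter.eventually_mul (M := FreeMonoid α) u u
  rw [huu] at huu'
  exact ⟨u, v, huu', hu, hv, hτv⟩

end Ultrafilters

section PerfectSets

open Filter Topology

open scoped ENNReal

variable {X : Type*} [TopologicalSpace X]

instance : Uncountable (ℕ → Bool) := by
  rw [← Cardinal.aleph0_lt_mk_iff]
  simpa using Cardinal.cantor Cardinal.aleph0

theorem not_countable_of_perfect [PolishSpace X] {M : Set X} (hM : Perfect M)
    (hne : M.Nonempty) : ¬ M.Countable := by
  let := TopologicalSpace.upgradeIsCompletelyMetrizable X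
  obtain ⟨f, hf, -, hinj⟩ := hM.exists_nat_bool_injection hne
  exact fun hcount => Set.not_countable_univ <|
    Set.MapsTo.countable_of_injOn (fun x _ => hf ⟨x, rfl⟩) hinj.injOn hcount

theorem countable_of_forall_exists_mem_nhdsWithin [SecondCountableTopology X] {D : Set X}
    (hD : ∀ x ∈ D, ∃ U ∈ 𝓝[D] x, U.Countable) : D.Countable := by
  choose! U hU hcount using hD
  obtain ⟨t, htD, ht, hDt⟩ := TopologicalSpace.countable_cover_nhdsWithin hU
  exact (ht.biUnion fun x hx => hcount x (htD hx)).mono hDt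

theorem nontrivial_setOf_condensation [SecondCountableTopology X] {D : Set X}
    (hD : ¬ D.Countable) : {x ∈ D | ∀ U ∈ 𝓝 x, ¬ (D ∩ U).Countable}.Nontrivial := by
  have hrest : {x ∈ D | ∃ U ∈ 𝓝 x, (D ∩ U).Countable}.Countable :=
    countable_of_forall_exists_mem_nhdsWithin fun x ⟨_, U, hU, hcount⟩ =>
      ⟨_, inter_mem_nhdsWithin _ hU, hcount.mono (Set.inter_subset_inter_left _ fun _ h => h.1)⟩
  by_contra hsub
  refine hD ((hrest.union (Set.not_nontrivial_iff.1 hsub).countable).mono fun x hx => ?_)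
  by_cases h : ∃ U ∈ 𝓝 x, (D ∩ U).Countable
  · exact .inl ⟨hx, h⟩
  · push Not at h
    exact .inr ⟨hx, h⟩

theorem exists_disjoint_uncountable_inter {X : Type*} [MetricSpace X]
    [SecondCountableTopology X] {D : Set X} (hD : ¬ D.Countable) {ε : ℝ≥0∞} (hε : 0 < ε) :
    ∃ U : Bool → Set X, (∀ b, IsClosed (U b) ∧ ¬ (D ∩ U b).Countable ∧ Metric.ediam (U b) ≤ ε) ∧
      Disjoint (U false) (U true) := by
  obtain ⟨x, hx, y, hy, hxy⟩ := nontrivial_setOf_condensation hD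
  obtain ⟨V, hV, W, hW, hVW⟩ := Filter.disjoint_iff.1 (disjoint_nhds_nhds.2 hxy)
  have hsmall : ∀ z : X, ∀ V ∈ 𝓝 z, ∃ U ∈ 𝓝 z, IsClosed U ∧ U ⊆ V ∧ Metric.ediam U ≤ ε := by
    intro z V hV
    obtain ⟨U, hU, hclosed, hUV⟩ := exists_mem_nhds_isClosed_subset
      (inter_mem hV (Metric.closedEBall_mem_nhds z (ENNReal.half_pos hε.ne')))
    refine ⟨U, hU, hclosed, hUV.trans Set.inter_subset_left, ?_⟩
    calc Metric.ediam U ≤ Metric.ediam (Metric.closedEBall z (ε / 2)) :=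
          Metric.ediam_mono (hUV.trans Set.inter_subset_right)
      _ ≤ 2 * (ε / 2) := Metric.ediam_closedEBall_le
      _ = ε := ENNReal.mul_div_cancel two_ne_zero ENNReal.ofNat_ne_top
  obtain ⟨K, hK, hKclosed, hKV, hKε⟩ := hsmall x V hV
  obtain ⟨K', hK', hK'closed, hK'W, hK'ε⟩ := hsmall y W hW
  refine ⟨fun b => cond b K K', fun b => ?_, (hVW.mono hKV hK'W).symm⟩
  cases b
  · exact ⟨hK'closed, hy.2 K' hK', hK'ε⟩
  · exact ⟨hKclosed, hx.2 K hK, hKε⟩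

theorem exists_perfect_of_cantorScheme {X : Type*} [MetricSpace X] [CompleteSpace X]
    [SecondCountableTopology X] {A : List Bool → Set X} (hclosed : CantorScheme.ClosureAntitone A)
    (hdisj : CantorScheme.Disjoint A) (hdiam : CantorScheme.VanishingDiam A)
    (hne : ∀ l, (A l).Nonempty) :
    ∃ M, Perfect M ∧ M.Nonempty ∧ ∀ n, M ⊆ ⋃ l ∈ {l : List Bool | l.length = n}, A l := by
  have huniv := hclosed.map_of_vanishingDiam hdiam hne
  let f : (ℕ → Bool) → X := fun x => (CantorScheme.inducedMap A).2 ⟨x, huniv ▸ Set.mem_univ x⟩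
  have hf : Continuous f := hdiam.map_continuous.comp (by fun_prop)
  have hinj : Function.Injective f := fun x y hxy =>
    congrArg Subtype.val (hdisj.map_injective hxy)
  obtain ⟨M, hM, hMne, hMf⟩ := exists_perfect_nonempty_of_isClosed_of_not_countable
    (isCompact_range hf).isClosed fun hcount => Set.not_countable_univ <|
      Set.MapsTo.countable_of_injOn (fun x _ => Set.mem_range_self x) hinj.injOn hcount
  refine ⟨M, hM, hMne, fun n x hx => ?_⟩
  obtain ⟨y, rfl⟩ := hMf hx
  exact Set.mem_biUnion (PiNat.res_length y n) (CantorScheme.map_mem _ n)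

/-- `M` is covered by finitely many closed sets with the property `p`. -/
def CoveredBy (p : Set X → Prop) (M : Set X) : Prop :=
  ∃ F : Set (Set X), F.Finite ∧ (∀ N ∈ F, IsClosed N ∧ p N) ∧ M ⊆ ⋃₀ F

theorem CoveredBy.exists_perfect [PolishSpace X] {p : Set X → Prop} {M N : Set X}
    (hM : CoveredBy p M) (hN : Perfect N) (hne : N.Nonempty) (hNM : N ⊆ M) :
    ∃ K, p K ∧ ∃ N', Perfect N' ∧ N'.Nonempty ∧ N' ⊆ N ∧ N' ⊆ K := by
  obtain ⟨F, hF, hFp, hMF⟩ := hM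
  obtain ⟨K, hK, hNK⟩ : ∃ K ∈ F, ¬ (N ∩ K).Countable := by
    by_contra! hcount
    refine not_countable_of_perfect hN hne ((hF.countable.biUnion hcount).mono fun x hx => ?_)
    obtain ⟨K, hK, hxK⟩ := hMF (hNM hx)
    exact Set.mem_biUnion hK ⟨hx, hxK⟩
  obtain ⟨N', hN', hne', hN'NK⟩ := exists_perfect_nonempty_of_isClosed_of_not_countable
    (hN.closed.inter (hFp K hK).1) hNK
  exact ⟨K, (hFp K hK).2, N', hN', hne', hN'NK.trans Set.inter_subset_left,
    hN'NK.trans Set.inter_subset_right⟩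

theorem CoveredBy.mono {p q : Set X → Prop} {M N : Set X} (hM : CoveredBy p M)
    (hpq : ∀ K, p K → q K) (hNM : N ⊆ M) : CoveredBy q N :=
  let ⟨F, hF, hFp, hMF⟩ := hM
  ⟨F, hF, fun K hK => ⟨(hFp K hK).1, hpq K (hFp K hK).2⟩, hNM.trans hMF⟩

end PerfectSets

section Fusion

open Filter Topology

open scoped ENNReal

theorem exists_seq_of_step {σ : Type*} {I : ℕ → σ → Prop} {R : ℕ → σ → σ → Prop} {s₀ : σ}
    (h₀ : I 0 s₀) (step : ∀ n s, I n s → ∃ s', I (n + 1) s' ∧ R n s s') :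
    ∃ f : ℕ → σ, f 0 = s₀ ∧ ∀ n, I n (f n) ∧ R n (f n) (f (n + 1)) := by
  choose g hgI hgR using step
  let f : ∀ n, {s // I n s} := fun n =>
    Nat.rec ⟨s₀, h₀⟩ (fun n s => ⟨g n s.1 s.2, hgI n s.1 s.2⟩) n
  exact ⟨fun n => (f n).1, rfl, fun n => ⟨(f n).2, hgR n _ (f n).2⟩⟩

variable {σ : Type*} {R : ℕ → σ → σ → Prop}

theorem exists_split_step {X : Type*} [MetricSpace X] [SecondCountableTopology X]
    {J : ℕ → σ → Set X → Prop}
    (hJ : ∀ n s N K, J n s N → IsClosed K → J n s (N ∩ K))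
    (step : ∀ n s {ι : Type} {T : Set ι} {P : ι → Set X}, T.Finite →
      (∀ i ∈ T, ¬ (P i).Countable ∧ J n s (P i)) →
      ∃ s', R n s s' ∧ ∃ P' : ι → Set X,
        ∀ i ∈ T, P' i ⊆ P i ∧ ¬ (P' i).Countable ∧ J (n + 1) s' (P' i))
    {n : ℕ} {s : σ} {P : List Bool → Set X}
    (hP : ∀ l, l.length = n → ¬ (P l).Countable ∧ J n s (P l)) {ε : ℝ≥0∞} (hε : 0 < ε) :
    ∃ (s' : σ) (P' : List Bool → Set X), R n s s' ∧
      (∀ l, l.length = n + 1 → ¬ (P' l).Countable ∧ J (n + 1) s' (P' l)) ∧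
      ∀ l : List Bool, l.length = n →
        (∀ b, closure (P' (b :: l)) ⊆ closure (P l) ∧ Metric.ediam (closure (P' (b :: l))) ≤ ε) ∧
        Disjoint (closure (P' (false :: l))) (closure (P' (true :: l))) := by
  choose! U hU hdisj using fun l hl => exists_disjoint_uncountable_inter (hP l hl).1 hε
  obtain ⟨s', hs', P', hP'⟩ := step n s (T := {l : List Bool | l.length = n + 1})
    (P := fun l => P l.tail ∩ U l.tail l.headI) (List.finite_length_eq Bool (n + 1)) fun l hl => by
      have hl' : l.tail.length = n := by rw [List.length_tail, hl, Nat.add_sub_cancel]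
      exact ⟨(hU _ hl' _).2.1, hJ _ _ _ _ (hP _ hl').2 (hU _ hl' _).1⟩
  have hP'U : ∀ b l, l.length = n → closure (P' (b :: l)) ⊆ U l b := fun b l hl =>
    closure_minimal ((hP' (b :: l) (by simp [hl])).1.trans Set.inter_subset_right) (hU l hl b).1
  refine ⟨s', P', hs', fun l hl => (hP' l hl).2, fun l hl => ⟨fun b => ⟨closure_mono ?_, ?_⟩, ?_⟩⟩
  · exact (hP' (b :: l) (by simp [hl])).1.trans Set.inter_subset_left
  · exact (Metric.ediam_mono (hP'U b l hl)).trans (hU l hl b).2.2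
  · exact (hdisj l hl).mono (hP'U _ l hl) (hP'U _ l hl)

/-- At stage `n`, the sets of a Cantor scheme are first split into `2 ^ (n + 1)` uncountable sets,
which `step` then refines simultaneously. -/
theorem exists_perfect_fusion {X : Type*} [TopologicalSpace X] [PolishSpace X]
    {J : ℕ → σ → Set X → Prop} (hJ : ∀ n s N K, J n s N → IsClosed K → J n s (N ∩ K))
    (step : ∀ n s {ι : Type} {T : Set ι} {P : ι → Set X}, T.Finite →
      (∀ i ∈ T, ¬ (P i).Countable ∧ J n s (P i)) →
      ∃ s', R n s s' ∧ ∃ P' : ι → Set X,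
        ∀ i ∈ T, P' i ⊆ P i ∧ ¬ (P' i).Countable ∧ J (n + 1) s' (P' i))
    {s₀ : σ} {D : Set X} (hD : ¬ D.Countable) (h₀ : J 0 s₀ D) :
    ∃ M, Perfect M ∧ M.Nonempty ∧ M ⊆ closure D ∧ ∃ s : ℕ → σ, s 0 = s₀ ∧
      ∀ n, R n (s n) (s (n + 1)) ∧ CoveredBy (fun N => ∃ P, J n (s n) P ∧ N = closure P) M := by
  let := TopologicalSpace.upgradeIsCompletelyMetrizable X
  obtain ⟨ε, -, hε, hε₀⟩ := exists_seq_strictAnti_tendsto' (zero_lt_one' ℝ≥0∞)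
  obtain ⟨f, hf₀, hf⟩ := exists_seq_of_step (s₀ := (s₀, fun _ : List Bool => D))
    (I := fun n p => ∀ l, l.length = n → ¬ (p.2 l).Countable ∧ J n p.1 (p.2 l))
    (R := fun n p p' => R n p.1 p'.1 ∧ ∀ l, l.length = n →
      (∀ b, closure (p'.2 (b :: l)) ⊆ closure (p.2 l) ∧
        Metric.ediam (closure (p'.2 (b :: l))) ≤ ε n) ∧
      Disjoint (closure (p'.2 (false :: l))) (closure (p'.2 (true :: l))))
    (fun _ _ => ⟨hD, h₀⟩) fun n p hp => by
      obtain ⟨s', P', hs', hP', hsplit⟩ := exists_split_step hJ step hp (hε n).1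
      exact ⟨(s', P'), hP', hs', hsplit⟩
  set A : List Bool → Set X := fun l => closure ((f l.length).2 l) with hA
  have hAsucc : ∀ l, (∀ b, A (b :: l) ⊆ A l ∧ Metric.ediam (A (b :: l)) ≤ ε l.length) ∧
      Disjoint (A (false :: l)) (A (true :: l)) := fun l => (hf l.length).2.2 l rfl
  have hclosed : CantorScheme.ClosureAntitone A := CantorScheme.Antitone.closureAntitone
    (fun l b => ((hAsucc l).1 b).1) fun _ => isClosed_closure
  have hdisj : CantorScheme.Disjoint A := by
    rintro l (_ | _) (_ | _) hne
    exacts [absurd rfl hne, (hAsucc l).2, (hAsucc l).2.symm, absurd rfl hne]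
  have hdiam : CantorScheme.VanishingDiam A := fun x =>
    (tendsto_add_atTop_iff_nat 1).1 <| tendsto_of_tendsto_of_tendsto_of_le_of_le
      tendsto_const_nhds hε₀ (fun _ => bot_le) fun n => by
        simpa using ((hAsucc (PiNat.res x n)).1 (x n)).2
  have hAne : ∀ l, (A l).Nonempty := fun l => Set.Nonempty.closure <|
    Set.nonempty_iff_ne_empty.2 fun h => ((hf l.length).1 l rfl).1 (h ▸ Set.countable_empty)
  obtain ⟨M, hM, hne, hMA⟩ := exists_perfect_of_cantorScheme hclosed hdisj hdiam hAne
  refine ⟨M, hM, hne, (hMA 0).trans (Set.iUnion₂_subset fun l hl => ?_), fun n => (f n).1,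
    congrArg Prod.fst hf₀, fun n => ⟨(hf n).2.1, _,
      (List.finite_length_eq Bool n).image A, ?_, ?_⟩⟩
  · simp [hA, List.length_eq_zero_iff.1 hl, hf₀]
  · rintro _ ⟨l, rfl, rfl⟩
    exact ⟨isClosed_closure, _, ((hf l.length).1 l rfl).2, rfl⟩
  · rw [Set.sUnion_image]
    exact hMA n

end Fusion

section Pigeonhole

open Filter

theorem eventually_not_countable {β X : Type*} [Countable β] {V : Ultrafilter β} {D : Set X}
    (hD : ¬ D.Countable) {p : β → X → Prop} (hp : ∀ x ∈ D, ∀ᶠ z in V, p z x) :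
    ∀ᶠ z in V, ¬ {x ∈ D | p z x}.Countable := by
  by_contra hcon
  simp only [← Ultrafilter.eventually_not, not_not] at hcon
  refine hD (((Set.to_countable {z | {x ∈ D | p z x}.Countable}).biUnion fun z hz => hz).mono
    fun x hx => ?_)
  obtain ⟨z, hz, hzx⟩ := (hcon.and (hp x hx)).exists
  exact Set.mem_biUnion hz ⟨hx, hzx⟩

theorem countable_of_cover {α : Type*} {L : ℕ → Finset α} (hcover : ∀ l : α, ∃ n, l ∈ L n) :
    Countable α := by
  rw [← Set.countable_univ_iff]
  exact (Set.countable_iUnion fun n => (L n).countable_toSet).mono fun l _ =>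
    Set.mem_iUnion.2 (hcover l)

theorem mem_of_isConcat {β : Type*} {P K : ℕ → Set (List β)} {d : ℕ} (h₀ : [] ∈ K 0)
    (hK : Monotone K) (hP : ∀ n, ∀ w ∈ K n, ∀ z ∈ P (d + n), w ++ z ∈ K (n + 1)) {w : List β}
    {s : Finset ℕ} (hw : IsConcat P w s) (hds : ∀ j ∈ s, d ≤ j) {n : ℕ}
    (hsn : ∀ j ∈ s, j < d + n) : w ∈ K n := by
  induction s using Finset.induction_on_max generalizing w n with
  | empty => exact hK n.zero_le (isConcat_empty.1 hw ▸ h₀)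
  | insert m s hm ih =>
    obtain ⟨w', hw', z, hz, rfl⟩ := (isConcat_insert hm).1 hw
    obtain ⟨k, rfl⟩ := Nat.exists_eq_add_of_le (hds m (Finset.mem_insert_self m s))
    have hkn : k + 1 ≤ n := by
      have := hsn _ (Finset.mem_insert_self _ s)
      omega
    exact hK hkn (hP k w' (ih hw' (fun j hj => hds j (Finset.mem_insert_of_mem hj)) hm) z hz)

theorem isBlock_of_mem_Ico {S : ℕ → Finset ℕ} {N : ℕ → ℕ} (hN : Monotone N)
    (hS : ∀ n, ∀ j ∈ S n, N n ≤ j ∧ j < N (n + 1)) : IsBlock S := fun n m hnm i hi j hj =>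
  (hS n i hi).2.trans_le ((hN hnm).trans (hS m j hj).1)

variable {α : Type*} {L : ℕ → Finset α}

/-- The words that can be used in the construction of a homogeneous sequence: `w` satisfies `p`
unless it is empty, and so does its concatenation with `u`-almost every word. -/
def Extendible (u : Ultrafilter (List α)) (p : List α → Prop) (w : List α) : Prop :=
  (w = [] ∨ p w) ∧ ∀ᶠ y in u, p (w ++ y)

theorem Extendible.eventually_append {u : Ultrafilter (List α)}
    (hu : ∀ p : List α → Prop, (∀ᶠ w in u, p w) ↔ ∀ᶠ w in u, ∀ᶠ w' in u, p (w ++ w'))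
    {p : List α → Prop} {w : List α} (hw : Extendible u p w) :
    ∀ᶠ y in u, Extendible u p (w ++ y) := by
  have happ := (hu fun y => p (w ++ y)).1 hw.2
  simp only [← List.append_assoc] at happ
  exact (hw.2.and happ).mono fun y hy => ⟨.inr hy.1, hy.2⟩

theorem exists_mem_tailVarWords_not_countable [Countable α] {X : VarWordSeq α}
    {u : Ultrafilter (List α)} {v : Ultrafilter (List (Option α))}
    (hu : ∀ p : List α → Prop, (∀ᶠ w in u, p w) ↔ ∀ᶠ w in u, ∀ᶠ w' in u, p (w ++ w'))
    (hv : ∀ m, tailVarWords L X m ∈ v) (huv : ∀ l, v.map (eval · l) = u)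
    {Ω ι : Type*} {p : Ω → List α → Prop} {T : Set ι} (hT : T.Finite) {P : ι → Set Ω}
    {G : Finset (List α)}
    (hP : ∀ i ∈ T, ¬ (P i).Countable ∧ ∀ x ∈ P i, ∀ w ∈ G, Extendible u (p x) w) (A : Finset α)
    (m : ℕ) :
    ∃ z ∈ tailVarWords L X m, ∀ i ∈ T,
      ¬ {x ∈ P i | ∀ w ∈ G, ∀ l ∈ A, Extendible u (p x) (w ++ eval z l)}.Countable := by
  have hz : ∀ i ∈ T, ∀ᶠ z in v,
      ¬ {x ∈ P i | ∀ w ∈ G, ∀ l ∈ A, Extendible u (p x) (w ++ eval z l)}.Countable := by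
    refine fun i hi => eventually_not_countable (hP i hi).1 fun x hx => ?_
    refine (eventually_all_finset G).2 fun w hw => (eventually_all_finset A).2 fun l _ => ?_
    have hy : ∀ᶠ y in v.map (eval · l), Extendible u (p x) (w ++ y) :=
      huv l ▸ ((hP i hi).2 x hx w hw).eventually_append hu
    exact hy
  exact ((eventually_of_mem (hv m) fun _ h => h).and
    ((eventually_all_finite hT).2 hz)).exists

theorem ne_nil_of_mem_tailWords {X : VarWordSeq α} {d : ℕ} {w : List α}
    (hw : w ∈ tailWords L X d) : w ≠ [] := by
  obtain ⟨s, hs, -⟩ := mem_tailWords.1 hw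
  obtain ⟨n, hn⟩ := hs.1
  rw [← List.length_pos_iff, hs.length]
  exact (Nat.zero_le _).trans_lt (X.2.2 n) |>.trans_le
    (Finset.single_le_sum (f := fun j => (X.1 j).length) (fun _ _ => Nat.zero_le _) hn)

theorem tailWords_subset_of_blockLE (hmono : Monotone L) {X Y : VarWordSeq α}
    (hYX : BlockLE L Y X) (d : ℕ) : tailWords L Y d ⊆ tailWords L X d := by
  intro w hw
  obtain ⟨S, hS, hblock⟩ := hYX
  obtain ⟨s, hs, hds⟩ := mem_tailWords.1 hw
  refine mem_tailWords.2 ⟨_, hs.biUnion hmono hblock hS, fun j hj => ?_⟩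
  obtain ⟨n, hn, hj⟩ := Finset.mem_biUnion.1 hj
  exact (hds n hn).trans (IsBlock.le hblock (fun n => (hS n).1) hj)

theorem exists_basicVar_forall_tailWords_mem {X : VarWordSeq α} {d : ℕ} {N : ℕ → ℕ}
    {K : ℕ → Set (List α)} (hN₀ : N 0 = d) (h₀ : [] ∈ K 0)
    (h : ∀ n, ∃ z t, IsSuppVar L X z t ∧ (∀ j ∈ t, N n ≤ j ∧ j < N (n + 1)) ∧ K n ⊆ K (n + 1) ∧
      ∀ w ∈ K n, ∀ l ∈ L (d + n), w ++ eval z l ∈ K (n + 1)) :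
    ∃ Y ∈ basicVar L d X, ∀ w ∈ tailWords L Y d, ∃ n, w ∈ K n := by
  choose z t hzt htN hK hzK using h
  have hN : Monotone N := monotone_nat_of_le_succ fun n =>
    let ⟨j, hj⟩ := (hzt n).1
    (htN n j hj).1.trans (htN n j hj).2.le
  obtain ⟨Y, hY, hYz⟩ := exists_mem_basicVar (d := d) ⟨t, isBlock_of_mem_Ico hN htN, fun n =>
    ⟨hzt n, fun j hj => hN₀.ge.trans ((hN n.zero_le).trans (htN n j hj).1)⟩⟩
  refine ⟨Y, hY, fun w ⟨s, _, hds, hw⟩ => ?_⟩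
  obtain ⟨n, hn⟩ := s.exists_nat_subset_range
  refine ⟨n, mem_of_isConcat h₀ (monotone_nat_of_le_succ hK) ?_ hw hds fun j hj =>
    (Finset.mem_range.1 (hn hj)).trans_le (Nat.le_add_left n d)⟩
  rintro n w hw _ ⟨l, hl, rfl⟩
  exact hYz n ▸ hzK n w hw l hl

theorem exists_perfect_forall_tailWords_subset [Countable α] (hmono : Monotone L) {X : VarWordSeq α}
    {d : ℕ} {u : Ultrafilter (List α)} {v : Ultrafilter (List (Option α))}
    (hu : ∀ p : List α → Prop, (∀ᶠ w in u, p w) ↔ ∀ᶠ w in u, ∀ᶠ w' in u, p (w ++ w'))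
    (hv : ∀ m, tailVarWords L X m ∈ v) (huv : ∀ l, v.map (eval · l) = u)
    {Ω : Type*} [TopologicalSpace Ω] [PolishSpace Ω] {D : Set Ω} (hD : ¬ D.Countable)
    {C : List α → Set Ω} (hC : ∀ w ∈ tailWords L X d, IsClosed (C w))
    (hDC : ∀ x ∈ D, ∀ᶠ w in u, x ∈ C w) :
    ∃ M, Perfect M ∧ M.Nonempty ∧ M ⊆ closure D ∧ ∃ Y ∈ basicVar L d X,
      ∀ w ∈ tailWords L Y d, M ⊆ C w := by
  classical
  obtain ⟨M, hM, hne, hMD, s, hs₀, hs⟩ := exists_perfect_fusion (σ := ℕ × Finset (List α))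
    (R := fun n s s' => ∃ z t, IsSuppVar L X z t ∧ (∀ j ∈ t, s.1 ≤ j ∧ j < s'.1) ∧ s.2 ⊆ s'.2 ∧
      ∀ w ∈ s.2, ∀ l ∈ L (d + n), w ++ eval z l ∈ s'.2)
    (J := fun _ s P => ∀ x ∈ P, ∀ w ∈ s.2, Extendible u (x ∈ C ·) w)
    (fun _ _ _ _ hP _ x hx => hP x hx.1) (fun n s ι T P hT hP => by
      obtain ⟨z, hz, hcount⟩ :=
        exists_mem_tailVarWords_not_countable hu hv huv hT hP (L (d + n)) s.1
      obtain ⟨t, ht, hst⟩ := mem_tailVarWords.1 hz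
      obtain ⟨k, hk⟩ := t.exists_nat_subset_range
      refine ⟨(k, s.2 ∪ Finset.image₂ (fun w l => w ++ eval z l) s.2 (L (d + n))), ⟨z, t, ht,
        fun j hj => ⟨hst j hj, Finset.mem_range.1 (hk hj)⟩, Finset.subset_union_left,
        fun w hw l hl => Finset.mem_union_right _ (Finset.mem_image₂_of_mem hw hl)⟩, _,
        fun i hi => ⟨Set.sep_subset _ _, hcount i hi, fun x hx w hw => ?_⟩⟩
      obtain hw | hw := Finset.mem_union.1 hw
      · exact (hP i hi).2 x hx.1 w hw
      · obtain ⟨w', hw', l, hl, rfl⟩ := Finset.mem_image₂.1 hw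
        exact hx.2 w' hw' l hl)
    (s₀ := (d, {[]})) hD fun x hx w hw =>
      Finset.mem_singleton.1 hw ▸ ⟨.inl rfl, by simpa using hDC x hx⟩
  obtain ⟨Y, hY, hYs⟩ := exists_basicVar_forall_tailWords_mem (L := L) (X := X) (d := d)
    (K := fun n => ((s n).2 : Set (List α))) (N := fun n => (s n).1) (congrArg Prod.fst hs₀)
    (by simp [hs₀]) fun n => (hs n).1
  refine ⟨M, hM, hne, hMD, Y, hY, fun w hw => ?_⟩
  obtain ⟨n, hn⟩ := hYs w hw
  obtain ⟨F, -, hF, hMF⟩ := (hs n).2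
  refine hMF.trans (Set.sUnion_subset fun N hN => ?_)
  obtain ⟨-, P, hP, rfl⟩ := hF N hN
  exact closure_minimal (fun x hx => (hP x hx w hn).1.resolve_left (ne_nil_of_mem_tailWords hw))
    (hC w (tailWords_subset_of_blockLE hmono (mem_basicVar.1 hY).1 d hw))

theorem exists_forall_tailWords_coveredBy (hmono : Monotone L) (hcover : ∀ l : α, ∃ n, l ∈ L n)
    (l₀ : α) (X : VarWordSeq α) (d : ℕ) {Ω κ : Type*} [TopologicalSpace Ω] [PolishSpace Ω]
    [Finite κ] {M : Set Ω} (hM : Perfect M) (hne : M.Nonempty) {ψ : κ → List α → Set Ω → Prop}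
    (hψ : ∀ w ∈ tailWords L X d, CoveredBy (fun N => ∃ i, ψ i w N) M) :
    ∃ i M', Perfect M' ∧ M'.Nonempty ∧ M' ⊆ M ∧ ∃ Y ∈ basicVar L d X,
      ∀ w ∈ tailWords L Y d, CoveredBy (ψ i w) M' := by
  have := countable_of_cover hcover
  obtain ⟨u, v, hu, huX, hvX, huv⟩ := exists_idempotent_ultrafilter hmono hcover l₀ X
  choose! F hF hFψ hMF using hψ
  let C : κ → List α → Set Ω := fun i w => ⋃₀ {N ∈ F w | IsClosed N ∧ ψ i w N}
  have hMC : ∀ w ∈ tailWords L X d, ∀ x ∈ M, ∃ i, x ∈ C i w := fun w hw x hx =>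
    let ⟨N, hN, hxN⟩ := hMF w hw hx
    let ⟨hNc, i, hi⟩ := hFψ w hw N hN
    ⟨i, N, ⟨hN, hNc, hi⟩, hxN⟩
  have hCclosed : ∀ i, ∀ w ∈ tailWords L X d, IsClosed (C i w) := fun i w hw => by
    simp only [C, Set.sUnion_eq_biUnion]
    exact ((hF w hw).subset (Set.sep_subset _ _)).isClosed_biUnion fun N hN => hN.2.1
  obtain ⟨i, hi⟩ : ∃ i, ¬ {x ∈ M | ∀ᶠ w in u, x ∈ C i w}.Countable := by
    by_contra! hcount
    refine not_countable_of_perfect hM hne ((Set.countable_iUnion hcount).mono fun x hx => ?_)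
    obtain ⟨i, hi⟩ := Ultrafilter.eventually_exists_iff.1
      (eventually_of_mem (huX d) fun w hw => hMC w hw x hx)
    exact Set.mem_iUnion.2 ⟨i, hx, hi⟩
  obtain ⟨M', hM', hne', hM'M, Y, hY, hYC⟩ := exists_perfect_forall_tailWords_subset hmono hu hvX
    huv hi (hCclosed i) fun x hx => hx.2
  refine ⟨i, M', hM', hne', hM'M.trans (closure_minimal (Set.sep_subset _ _) hM.closed), Y, hY,
    fun w hw => ⟨_, (hF w ?_).subset (Set.sep_subset _ _), fun N hN => hN.2, hYC w hw⟩⟩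
  exact tailWords_subset_of_blockLE hmono (mem_basicVar.1 hY).1 d hw

end Pigeonhole

section BlockFusion

variable {α : Type*} {L : ℕ → Finset α}

theorem blockLE_of_forall_exists_eq {X Z : VarWordSeq α}
    (h : ∀ m, ∃ Y, BlockLE L Y X ∧ ∀ i < m, Z.1 i = Y.1 i) : BlockLE L Z X := by
  choose Y hYX hZY using h
  choose S hS hblock using hYX
  have hZ : ∀ {m i}, i < m → IsSuppVar L X (Z.1 i) (S m i) := fun {m i} hi =>
    hZY m i hi ▸ hS m i
  refine ⟨fun i => S (i + 1) i, fun i => hZ i.lt_succ_self, fun n m hnm => ?_⟩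
  have hS_eq : S (n + 1) n = S (m + 1) n := (hZ n.lt_succ_self).unique (hZ (Nat.lt_succ_of_lt hnm))
  simpa only [hS_eq] using hblock (m + 1) n m hnm

theorem exists_limit (hmono : Monotone L) (d : ℕ) {Xs : ℕ → VarWordSeq α}
    (h : ∀ k, Xs (k + 1) ∈ basicVar L (d + k) (Xs k)) :
    ∃ X : VarWordSeq α, ∀ k, X ∈ basicVar L (d + k) (Xs k) := by
  have hle : ∀ k j, k ≤ j → Xs j ∈ basicVar L (d + k) (Xs k) := by
    intro k j hkj
    induction j, hkj using Nat.le_induction with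
    | base => exact mem_basicVar_self _ _
    | succ j hkj ih => exact basicVar_trans hmono (basicVar_antitone _ (by omega) (h j)) ih
  have heq : ∀ k, ∀ i < d + k, (Xs (i + 1)).1 i = (Xs k).1 i := by
    intro k i hi
    obtain hk | hk := le_total k (i + 1)
    · exact (mem_basicVar.1 (hle _ _ hk)).2 i hi
    · exact ((mem_basicVar.1 (hle _ _ hk)).2 i (by omega)).symm
  have hrapid : RapidlyIncreasing fun i => (Xs (i + 1)).1 i := by
    refine fun n => (Finset.sum_congr rfl fun i hi => ?_).trans_lt ((Xs (n + 1)).2.2 n)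
    exact congrArg List.length (heq (n + 1) i (by have := Finset.mem_range.1 hi; omega))
  refine ⟨⟨_, fun n => (Xs (n + 1)).2.1 n, hrapid⟩, fun k => mem_basicVar.2
    ⟨blockLE_of_forall_exists_eq fun m => ⟨Xs (max k m), ?_, fun i hi => heq _ i ?_⟩, heq k⟩⟩
  · exact (mem_basicVar.1 (hle k _ (le_max_left k m))).1
  · exact hi.trans_le ((le_max_right k m).trans (Nat.le_add_left _ d))

theorem depth_eq_of_depth_le {X Y : VarWordSeq α} {a : List (List α)} {n : ℕ}
    (hY : Y ∈ basicVar L n X) (ha : (basic L a Y).Nonempty) (hn : depth L Y a ≤ n) :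
    depth L X a = depth L Y a :=
  depth_congr (finLE₀_depth ha) fun i hi => (mem_basicVar.1 hY).2 i (hi.trans_le hn)

variable {Ω : Type*}

/-- Properties of triples `(M, b, X)`, thought of as products `M × [b, X]`, that are inherited by
smaller products. -/
def IsHereditary (L : ℕ → Finset α) (Φ : Set Ω → List (List α) → VarWordSeq α → Prop) : Prop :=
  ∀ ⦃M M' b X X'⦄, M' ⊆ M → basic L b X' ⊆ basic L b X → Φ M b X → Φ M' b X'

/-- Properties of triples `(M, b, X)` that can be forced by shrinking the perfect set `M`, and `X`
beyond the depth of `b`. -/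
def IsDense [TopologicalSpace Ω] (L : ℕ → Finset α)
    (Φ : Set Ω → List (List α) → VarWordSeq α → Prop) : Prop :=
  ∀ ⦃M⦄, Perfect M → M.Nonempty → ∀ ⦃b X⦄, (basic L b X).Nonempty →
    ∃ M', Perfect M' ∧ M'.Nonempty ∧ M' ⊆ M ∧ ∃ X' ∈ basicVar L (depth L X b) X, Φ M' b X'

variable [TopologicalSpace Ω] {Φ : Set Ω → List (List α) → VarWordSeq α → Prop}

theorem exists_refinement_forall_finset (hmono : Monotone L) (hΦ : IsHereditary L Φ)
    (hΦd : IsDense L Φ) {ι : Type*} {T : Set ι} {P : ι → Set Ω}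
    (hP : ∀ i ∈ T, Perfect (P i) ∧ (P i).Nonempty)
    {X : VarWordSeq α} {n : ℕ} {U : Finset (ι × List (List α))}
    (hU : ∀ t ∈ U, t.1 ∈ T ∧ (basic L t.2 X).Nonempty ∧ depth L X t.2 = n) :
    ∃ X' ∈ basicVar L n X, ∃ P' : ι → Set Ω,
      (∀ i ∈ T, (Perfect (P' i) ∧ (P' i).Nonempty) ∧ P' i ⊆ P i) ∧
        ∀ t ∈ U, Φ (P' t.1) t.2 X' := by
  classical
  induction U using Finset.induction_on with
  | empty =>
    exact ⟨X, mem_basicVar_self _ _, P, fun i hi => ⟨hP i hi, subset_rfl⟩, by simp⟩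
  | insert t U _ ih =>
    obtain ⟨X₁, hX₁, P₁, hP₁, hΦ₁⟩ := ih fun t ht => hU t (Finset.mem_insert_of_mem ht)
    obtain ⟨htT, htX, htn⟩ := hU t (Finset.mem_insert_self t U)
    have htX₁ : X₁ ∈ basicVar L (depth L X t.2) X := by rwa [htn]
    obtain ⟨M, hM, hne, hMP₁, X₂, hX₂, hΦM⟩ := hΦd (hP₁ _ htT).1.1 (hP₁ _ htT).1.2
      (basic_nonempty_of_mem_basicVar hmono htX htX₁)
    rw [depth_eq_of_mem_basicVar htX htX₁, htn] at hX₂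
    have hupdate : ∀ i, Function.update P₁ t.1 M i ⊆ P₁ i :=
      update_le_self_iff.2 hMP₁
    refine ⟨X₂, basicVar_trans hmono hX₂ hX₁, Function.update P₁ t.1 M, fun i hi => ⟨?_,
      (hupdate i).trans (hP₁ i hi).2⟩, fun t' ht' => ?_⟩
    · obtain rfl | hne' := eq_or_ne i t.1
      · simpa only [Function.update_self] using ⟨hM, hne⟩
      · simpa only [Function.update_of_ne hne'] using (hP₁ i hi).1
    · obtain rfl | ht' := Finset.mem_insert.1 ht'
      · simpa only [Function.update_self] using hΦM
      · exact hΦ (hupdate _) (basic_subset_of_blockLE hmono (mem_basicVar.1 hX₂).1 _) (hΦ₁ t' ht')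

variable [PolishSpace Ω]

theorem exists_fusion_step (hmono : Monotone L) (hΦ : IsHereditary L Φ) (hΦd : IsDense L Φ)
    {ι : Type*} {T : Set ι} (hT : T.Finite) {P : ι → Set Ω}
    (hP : ∀ i ∈ T, ¬ (P i).Countable ∧ IsClosed (P i)) (X : VarWordSeq α) (n : ℕ) :
    ∃ X' ∈ basicVar L n X, ∃ P' : ι → Set Ω, ∀ i ∈ T, P' i ⊆ P i ∧ ¬ (P' i).Countable ∧
      IsClosed (P' i) ∧ ∀ b, (basic L b X).Nonempty → depth L X b = n → Φ (P' i) b X' := by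
  choose! P₁ hP₁ hne₁ hP₁P using fun i hi =>
    exists_perfect_nonempty_of_isClosed_of_not_countable (hP i hi).2 (hP i hi).1
  have hfin : {b | (basic L b X).Nonempty ∧ depth L X b = n}.Finite :=
    (finite_setOf_finLE₀ n).subset fun b hb => hb.2 ▸ finLE₀_depth hb.1
  have hmem := fun t => (hT.prod hfin).mem_toFinset (a := t)
  obtain ⟨X', hX', P', hP', hΦ'⟩ := exists_refinement_forall_finset hmono hΦ hΦd
    (fun i hi => ⟨hP₁ i hi, hne₁ i hi⟩) fun t ht => (hmem t).1 ht
  exact ⟨X', hX', P', fun i hi => ⟨(hP' i hi).2.trans (hP₁P i hi),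
    not_countable_of_perfect (hP' i hi).1.1 (hP' i hi).1.2, (hP' i hi).1.1.closed,
    fun b hb hbn => hΦ' (i, b) ((hmem _).2 ⟨hi, hb, hbn⟩)⟩⟩

theorem exists_forall_basic_coveredBy (hmono : Monotone L) (hΦ : IsHereditary L Φ)
    (hΦd : IsDense L Φ) {Q : Set Ω} (hQ : Perfect Q) (hne : Q.Nonempty) (d : ℕ)
    (Y : VarWordSeq α) :
    ∃ M, Perfect M ∧ M.Nonempty ∧ M ⊆ Q ∧ ∃ X ∈ basicVar L d Y,
      ∀ b, (basic L b X).Nonempty → d ≤ depth L X b → CoveredBy (Φ · b X) M := by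
  obtain ⟨M, hM, hMne, hMQ, Xs, rfl, hXs⟩ := exists_perfect_fusion (s₀ := Y)
    (R := fun n X X' => X' ∈ basicVar L (d + n) X)
    (J := fun n X N => IsClosed N ∧ ∀ b, (basic L b X).Nonempty → d ≤ depth L X b →
      depth L X b < d + n → Φ N b X)
    (fun n X N K hN hK => ⟨hN.1.inter hK, fun b hb hdb hbn =>
      hΦ Set.inter_subset_left subset_rfl (hN.2 b hb hdb hbn)⟩) (fun n X ι T P hT hP => by
      obtain ⟨X', hX', P', hP'⟩ := exists_fusion_step hmono hΦ hΦd hT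
        (fun i hi => ⟨(hP i hi).1, (hP i hi).2.1⟩) X (d + n)
      refine ⟨X', hX', P', fun i hi => ?_⟩
      obtain ⟨hP'P, hcount, hclosed, hΦ'⟩ := hP' i hi
      refine ⟨hP'P, hcount, hclosed, fun b hb hdb hbn => ?_⟩
      have hsub := basic_subset_of_blockLE hmono (mem_basicVar.1 hX').1 b
      have hdepth := depth_eq_of_depth_le hX' hb (Nat.lt_succ_iff.1 hbn)
      obtain hlt | heq := (Nat.lt_succ_iff.1 hbn).lt_or_eq
      · exact hΦ hP'P hsub ((hP i hi).2.2 b (hb.mono hsub) (hdepth ▸ hdb) (hdepth ▸ hlt))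
      · exact hΦ' b (hb.mono hsub) (hdepth.trans heq))
    (not_countable_of_perfect hQ hne) ⟨hQ.closed, fun b _ hdb hb => absurd hdb hb.not_ge⟩
  obtain ⟨X, hX⟩ := exists_limit hmono d fun n => (hXs n).1
  refine ⟨M, hM, hMne, hQ.closed.closure_eq ▸ hMQ, X, hX 0, fun b hb hdb => ?_⟩
  obtain ⟨n, hn⟩ : ∃ n, depth L X b < d + n := ⟨depth L X b + 1, by omega⟩
  have hsub := basic_subset_of_blockLE hmono (mem_basicVar.1 (hX n)).1 b
  have hdepth := depth_eq_of_depth_le (hX n) hb hn.le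
  refine (hXs n).2.mono ?_ subset_rfl
  rintro _ ⟨P, ⟨hP, hPΦ⟩, rfl⟩
  rw [hP.closure_eq]
  exact hΦ subset_rfl hsub (hPΦ b (hb.mono hsub) (hdepth ▸ hdb) (hdepth ▸ hn))

end BlockFusion

section Forcing

variable {α : Type*} {L : ℕ → Finset α} {X : VarWordSeq α}

theorem basic_subset_of_basic_prefix_subset {a b : List (List α)} {X' : VarWordSeq α}
    (hab : a <+: b) (h : basic L a X' ⊆ basic L a X) : basic L b X' ⊆ basic L b X :=
  fun _ hA => ⟨(h (basic_subset_of_prefix hab hA)).1, hA.2⟩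

theorem exists_append_of_basic_subset {a b : List (List α)} {Z : VarWordSeq α}
    (hZ : (basic L b Z).Nonempty) (hZX : basic L b Z ⊆ basic L a X) :
    ∃ c, (basic L (a ++ c) Z).Nonempty ∧ basic L (a ++ c) Z ⊆ basic L b Z := by
  obtain ⟨A, hA⟩ := hZ
  set n := max a.length b.length
  obtain ⟨c, hc⟩ : a <+: initSeg A.1 n :=
    (mem_basic.1 (hZX hA)).2 ▸ initSeg_prefix A.1 (le_max_left _ _)
  have hbc : b <+: a ++ c := by
    rw [hc, ← (mem_basic.1 hA).2]
    exact initSeg_prefix A.1 (le_max_right _ _)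
  exact ⟨c, ⟨A, hA.1, n, hc.symm⟩, basic_subset_of_prefix hbc⟩

variable {Ω : Type*}

theorem prod_basic_subset_of_forall_coveredBy [TopologicalSpace Ω] {Γ : Set (Ω × WordSeq α)}
    {M : Set Ω} {b : List (List α)} (h : ∀ w ∈ tailWords L X (depth L X b),
      CoveredBy (fun N => N ×ˢ basic L (b ++ [w]) X ⊆ Γ) M) : M ×ˢ basic L b X ⊆ Γ := by
  rintro ⟨x, A⟩ ⟨hx, hA⟩
  obtain ⟨F, -, hF, hMF⟩ := h _ (mem_tailWords_of_mem_basic hA)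
  obtain ⟨N, hN, hxN⟩ := hMF hx
  exact (hF N hN).2 ⟨hxN, mem_basic_concat hA⟩

/-- The product `M × [b, X]` is homogeneous for `Λ`. -/
def Decides (L : ℕ → Finset α) (Λ : Set (Ω × WordSeq α)) (M : Set Ω) (b : List (List α))
    (X : VarWordSeq α) : Prop :=
  M ×ˢ basic L b X ⊆ Λ ∨ M ×ˢ basic L b X ⊆ Λᶜ

theorem isHereditary_decides (Λ : Set (Ω × WordSeq α)) : IsHereditary L (Decides L Λ) :=
  fun _ _ _ _ _ hM hX h => h.imp (Set.prod_mono hM hX).trans (Set.prod_mono hM hX).trans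

variable [TopologicalSpace Ω]

/-- No nonempty product `N × [b, Z]` inside `M × [b, X]` with `N` perfect is homogeneous for `Λ`.
In particular this holds if `[b, X]` is empty. -/
def Rejects (L : ℕ → Finset α) (Λ : Set (Ω × WordSeq α)) (M : Set Ω) (b : List (List α))
    (X : VarWordSeq α) : Prop :=
  ∀ N, Perfect N → N.Nonempty → N ⊆ M → ∀ Z, (basic L b Z).Nonempty →
    basic L b Z ⊆ basic L b X → ¬ Decides L Λ N b Z

variable {Λ : Set (Ω × WordSeq α)} {M : Set Ω} {b : List (List α)}

theorem isHereditary_rejects (Λ : Set (Ω × WordSeq α)) : IsHereditary L (Rejects L Λ) :=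
  fun _ _ _ _ _ hM hX h N hN hne hNM Z hZ hZX => h N hN hne (hNM.trans hM) Z hZ (hZX.trans hX)

theorem rejects_of_nonempty_imp (h : (basic L b X).Nonempty → Rejects L Λ M b X) :
    Rejects L Λ M b X :=
  fun N hN hne hNM Z hZ hZX => h (hZ.mono hZX) N hN hne hNM Z hZ hZX

theorem exists_decides_of_not_rejects (hmono : Monotone L) (hcover : ∀ l : α, ∃ n, l ∈ L n)
    (h : ¬ Rejects L Λ M b X) :
    ∃ M', Perfect M' ∧ M'.Nonempty ∧ M' ⊆ M ∧ ∃ X' ∈ basicVar L (depth L X b) X,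
      Decides L Λ M' b X' := by
  simp only [Rejects, not_forall, not_not] at h
  obtain ⟨N, hN, hne, hNM, Z, hZ, hZX, h⟩ := h
  obtain ⟨Y, hY, hYZ⟩ := exists_mem_basicVar_basic_subset hmono hcover hZ hZX
  exact ⟨N, hN, hne, hNM, Y, hY, isHereditary_decides Λ subset_rfl hYZ h⟩

theorem isDense_decides_or_rejects (hmono : Monotone L) (hcover : ∀ l : α, ∃ n, l ∈ L n)
    (Λ : Set (Ω × WordSeq α)) :
    IsDense L fun M b X => Decides L Λ M b X ∨ Rejects L Λ M b X := by
  intro M hM hne b X _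
  by_cases h : Rejects L Λ M b X
  · exact ⟨M, hM, hne, subset_rfl, X, mem_basicVar_self _ _, .inr h⟩
  · obtain ⟨M', hM', hne', hM'M, X', hX', h⟩ := exists_decides_of_not_rejects hmono hcover h
    exact ⟨M', hM', hne', hM'M, X', hX', .inl h⟩

theorem isHereditary_decides_or_forall_rejects (Λ : Set (Ω × WordSeq α)) :
    IsHereditary L fun M b X => Decides L Λ M b X ∨ ∀ w, Rejects L Λ M (b ++ [w]) X :=
  fun _ _ _ _ _ hM hX h => h.imp (isHereditary_decides Λ hM hX) fun h w =>
    isHereditary_rejects Λ hM (basic_subset_of_basic_prefix_subset (List.prefix_append _ _) hX)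
      (h w)

variable [PolishSpace Ω]

theorem rejects_of_coveredBy (h : CoveredBy (fun N => Rejects L Λ N b X) M) :
    Rejects L Λ M b X := by
  intro N hN hne hNM Z hZ hZX hdec
  obtain ⟨K, hK, N', hN', hne', hN'N, hN'K⟩ := h.exists_perfect hN hne hNM
  exact hK N' hN' hne' hN'K Z hZ hZX (isHereditary_decides Λ hN'N subset_rfl hdec)

theorem exists_forall_concat_coveredBy (hmono : Monotone L) (hcover : ∀ l : α, ∃ n, l ∈ L n)
    (Λ : Set (Ω × WordSeq α)) (hM : Perfect M) (hne : M.Nonempty) (hX : (basic L b X).Nonempty) :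
    ∃ M', Perfect M' ∧ M'.Nonempty ∧ M' ⊆ M ∧ ∃ X' ∈ basicVar L (depth L X b) X,
      ∀ w ∈ tailWords L X' (depth L X' b), CoveredBy (fun N =>
        Decides L Λ N (b ++ [w]) X' ∨ Rejects L Λ N (b ++ [w]) X') M' := by
  obtain ⟨M', hM', hne', hM'M, X', hX', h⟩ := exists_forall_basic_coveredBy hmono
    (fun _ _ _ _ _ hM hX h => h.imp (isHereditary_decides Λ hM hX) (isHereditary_rejects Λ hM hX))
    (isDense_decides_or_rejects hmono hcover Λ) hM hne (depth L X b) X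
  refine ⟨M', hM', hne', hM'M, X', hX', fun w hw => ?_⟩
  have hbw := (basic_concat_nonempty_iff hmono (basic_nonempty_of_mem_basicVar hmono hX hX')).2 hw
  exact h _ hbw (depth_eq_of_mem_basicVar hX hX' ▸ depth_le_of_prefix (List.prefix_append _ _) hbw)

theorem isDense_decides_or_forall_rejects (hmono : Monotone L) (hcover : ∀ l : α, ∃ n, l ∈ L n)
    (Λ : Set (Ω × WordSeq α)) :
    IsDense L fun M b X => Decides L Λ M b X ∨ ∀ w, Rejects L Λ M (b ++ [w]) X := by
  intro M hM hne b X hX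
  obtain ⟨M₁, hM₁, hne₁, hM₁M, X₁, hX₁, h₁⟩ :=
    exists_forall_concat_coveredBy hmono hcover Λ hM hne hX
  have hbX₁ := basic_nonempty_of_mem_basicVar hmono hX hX₁
  obtain ⟨-, l₀, -⟩ := exists_letter hX
  let ψ : Fin 3 → List α → Set Ω → Prop := ![fun w N => N ×ˢ basic L (b ++ [w]) X₁ ⊆ Λ,
    fun w N => N ×ˢ basic L (b ++ [w]) X₁ ⊆ Λᶜ, fun w N => Rejects L Λ N (b ++ [w]) X₁]
  obtain ⟨i, M₂, hM₂, hne₂, hM₂M₁, X₂, hX₂, h₂⟩ := exists_forall_tailWords_coveredBy (ψ := ψ)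
    hmono hcover l₀ X₁ (depth L X₁ b) hM₁ hne₁ fun w hw => (h₁ w hw).mono (by
      rintro N ((h | h) | h)
      exacts [⟨0, h⟩, ⟨1, h⟩, ⟨2, h⟩]) subset_rfl
  have hsub := basic_subset_of_blockLE hmono (mem_basicVar.1 hX₂).1
  have hbX₂ := basic_nonempty_of_mem_basicVar hmono hbX₁ hX₂
  rw [← depth_eq_of_mem_basicVar hbX₁ hX₂] at h₂
  have hhom : ∀ {Γ : Set (Ω × WordSeq α)}, (∀ w ∈ tailWords L X₂ (depth L X₂ b),
      CoveredBy (fun N => N ×ˢ basic L (b ++ [w]) X₁ ⊆ Γ) M₂) → M₂ ×ˢ basic L b X₂ ⊆ Γ :=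
    fun h => prod_basic_subset_of_forall_coveredBy fun w hw =>
      (h w hw).mono (fun N => (Set.prod_mono_right (hsub _)).trans) subset_rfl
  rw [depth_eq_of_mem_basicVar hX hX₁] at hX₂
  refine ⟨M₂, hM₂, hne₂, hM₂M₁.trans hM₁M, X₂, basicVar_trans hmono hX₂ hX₁, ?_⟩
  fin_cases i
  · exact .inl (.inl (hhom h₂))
  · exact .inl (.inr (hhom h₂))
  · refine .inr fun w => rejects_of_nonempty_imp fun hw => ?_
    exact isHereditary_rejects Λ subset_rfl (hsub _)
      (rejects_of_coveredBy (h₂ w ((basic_concat_nonempty_iff hmono hbX₂).1 hw)))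

theorem Rejects.append {a : List (List α)}
    (h : ∀ b, a <+: b → (basic L b X).Nonempty → CoveredBy (fun N =>
      Decides L Λ N b X ∨ ∀ w, Rejects L Λ N (b ++ [w]) X) M)
    (ha : Rejects L Λ M a X) (c : List (List α)) : Rejects L Λ M (a ++ c) X := by
  induction c using List.reverseRecOn with
  | nil => rwa [List.append_nil]
  | append_singleton c w ih =>
    rw [← List.append_assoc]
    refine rejects_of_nonempty_imp fun hw N hN hne hNM => ?_
    have hc := hw.mono (basic_subset_of_prefix (List.prefix_append (a ++ c) [w]))
    obtain ⟨K, hK, N', hN', hne', hN'N, hN'K⟩ :=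
      (h _ (List.prefix_append a c) hc).exists_perfect hN hne hNM
    intro Z hZ hZX hdec
    obtain hK | hK := hK
    · exact ih N' hN' hne' (hN'N.trans hNM) X hc subset_rfl
        (isHereditary_decides Λ hN'K subset_rfl hK)
    · exact hK w N' hN' hne' hN'K Z hZ hZX (isHereditary_decides Λ hN'N subset_rfl hdec)

end Forcing

section PerfectlyRamsey

instance : PolishSpace (ℕ → Bool) where

variable {α : Type*} {L : ℕ → Finset α} {Λ : Set ((ℕ → Bool) × WordSeq α)}

theorem PerfectlyBaire.exists_not_rejects (hΛ : PerfectlyBaire L Λ) {M : Set (ℕ → Bool)}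
    (hM : M ∈ perfectSets) {a : List (List α)} {X : VarWordSeq α} (hX : (basic L a X).Nonempty) :
    ∃ c, ¬ Rejects L Λ M (a ++ c) X := by
  obtain ⟨N, hN, hNM, b, Z, hZ, hZX, hdec⟩ := hΛ M hM a X hX
  obtain ⟨c, hc, hcZ⟩ := exists_append_of_basic_subset hZ hZX
  refine ⟨c, fun hrej => hrej N hN.1 hN.2 hNM Z hc (fun B hB => ⟨(hZX (hcZ hB)).1, hB.2⟩) ?_⟩
  exact hdec.imp (Set.prod_mono_right hcZ).trans (Set.prod_mono_right hcZ).trans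

theorem PerfectlyBaire.perfectlyRamsey (hmono : Monotone L) (hcover : ∀ l : α, ∃ n, l ∈ L n)
    (hΛ : PerfectlyBaire L Λ) : PerfectlyRamsey L Λ := by
  intro Q hQ a Y hY
  obtain ⟨M, hM, hne, hMQ, X, hX, h⟩ := exists_forall_basic_coveredBy hmono
    (isHereditary_decides_or_forall_rejects Λ) (isDense_decides_or_forall_rejects hmono hcover Λ)
    hQ.1 hQ.2 (depth L Y a) Y
  have haX := basic_nonempty_of_mem_basicVar hmono hY hX
  have hdepth := depth_eq_of_mem_basicVar hY hX
  have hrej : ¬ Rejects L Λ M a X := by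
    intro hrej
    obtain ⟨c, hc⟩ := hΛ.exists_not_rejects ⟨hM, hne⟩ haX
    exact hc (hrej.append (fun b hab hb => h b hb (hdepth ▸ depth_le_of_prefix hab hb)) c)
  obtain ⟨M', hM', hne', hM'M, X', hX', hdec⟩ := exists_decides_of_not_rejects hmono hcover hrej
  have haX' := basic_nonempty_of_mem_basicVar hmono haX hX'
  rw [hdepth] at hX'
  exact ⟨M', ⟨hM', hne'⟩, hM'M.trans hMQ, X', basicVar_trans hmono hX' hX, haX', hdec⟩

theorem PerfectlyRamsey.perfectlyBaire (hmono : Monotone L) (hΛ : PerfectlyRamsey L Λ) :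
    PerfectlyBaire L Λ := by
  intro Q hQ a Y hY
  obtain ⟨M, hM, hMQ, X, hX, hne, h⟩ := hΛ Q hQ a Y hY
  exact ⟨M, hM, hMQ, a, X, hne, basic_subset_of_blockLE hmono (mem_basicVar.1 hX).1 a, h⟩

theorem PerfectlyRamseyNull.perfectlyMeager (hmono : Monotone L) (hΛ : PerfectlyRamseyNull L Λ) :
    PerfectlyMeager L Λ := by
  intro Q hQ a Y hY
  obtain ⟨M, hM, hMQ, X, hX, hne, h⟩ := hΛ Q hQ a Y hY
  exact ⟨M, hM, hMQ, a, X, hne, basic_subset_of_blockLE hmono (mem_basicVar.1 hX).1 a, h⟩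

theorem PerfectlyMeager.perfectlyBaire (hΛ : PerfectlyMeager L Λ) : PerfectlyBaire L Λ := by
  intro Q hQ a Y hY
  obtain ⟨M, hM, hMQ, b, X, hne, hsub, h⟩ := hΛ Q hQ a Y hY
  exact ⟨M, hM, hMQ, b, X, hne, hsub, .inr h⟩

theorem PerfectlyMeager.perfectlyRamseyNull (hmono : Monotone L)
    (hcover : ∀ l : α, ∃ n, l ∈ L n) (hΛ : PerfectlyMeager L Λ) : PerfectlyRamseyNull L Λ := by
  intro Q hQ a Y hY
  obtain ⟨M, hM, hMQ, X, hX, hne, h⟩ :=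
    hΛ.perfectlyBaire.perfectlyRamsey hmono hcover Q hQ a Y hY
  refine ⟨M, hM, hMQ, X, hX, hne, h.resolve_left fun hΛM => ?_⟩
  obtain ⟨N, ⟨-, x, hx⟩, hNM, b, Z, ⟨A, hA⟩, hZX, hNZ⟩ := hΛ M hM a X hne
  exact hNZ (Set.mk_mem_prod hx hA) (hΛM ⟨hNM hx, hZX hA⟩)

end PerfectlyRamsey

end HalesJewettSpace

theorem mainTheorem3 {α : Type*} (L : ℕ → Finset α) (hmono : Monotone L)
    (hcover : ∀ l : α, ∃ n, l ∈ L n)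
    (Λ : Set ((ℕ → Bool) × HalesJewettSpace.WordSeq α)) :
    (HalesJewettSpace.PerfectlyRamsey L Λ ↔ HalesJewettSpace.PerfectlyBaire L Λ) ∧
      (HalesJewettSpace.PerfectlyRamseyNull L Λ ↔ HalesJewettSpace.PerfectlyMeager L Λ) :=
  ⟨⟨fun h => h.perfectlyBaire hmono, fun h => h.perfectlyRamsey hmono hcover⟩,
    ⟨fun h => h.perfectlyMeager hmono, fun h => h.perfectlyRamseyNull hmono hcover⟩⟩
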